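/- Let $\chi\in C^\infty(\mathbb R)$ be real-valued and even, with $\chi\equiv 0$ in a neighbourhood of $0$ and $\chi(\xi)=1$ for $|\xi|\ge 1$, and let $\gamma>0$. Consider the distributions $u,v\in\mathcal D'(\mathbb R^2)$ in the variables $(x,t)$ given, in the sense of oscillatory integrals, by $$u(x,t)=\int_{\mathbb R} e^{i(t|\xi|-x\xi)}\,\frac{\chi(\xi)}{|\xi|}\,d\xi,\qquad v(x,t)=\int_{\mathbb R} e^{i(t|\xi|-x\xi/\gamma)}\,\frac{\chi(\xi/\gamma)}{\gamma|\xi|}\,d\xi .$$ Writing points of the cotangent bundle as $(x,t,\xi,\tau)$, the wave front sets are exactly $$\mathrm{WF}(u)=\{(t,\pm t,-\xi,|\xi|) : t\in\mathbb R,\ \pm\xi>0\},\qquad \mathrm{WF}(v)=\{(\gamma t,\pm t,-\xi/\gamma,|\xi|) : t\in\mathbb R,\ \pm\xi>0\},$$ where in each set the two signs $\pm$ agree. Moreover, for every $x\in\mathbb R$ (in particular for every $x>0$), the restrictions $u_x$ and $v_x$ of $u$ and $v$ to the line $\{x\}\times\mathbb R$ exist and are uniquely determined, as pullbacks under the embedding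 $t\mapsto(x,t)$, that is, by continuous extension of the restriction of smooth functions to distributions whose wave front set contains no conormal of the line. They are the one-dimensional oscillatory integrals $$u_x(t)=\int_{\mathbb R} e^{i(t|\xi|-x\xi)}\,\frac{\chi(\xi)}{|\xi|}\,d\xi,\qquad v_x(t)=\int_{\mathbb R} e^{i(t|\xi|-x\xi/\gamma)}\,\frac{\chi(\xi/\gamma)}{\gamma|\xi|}\,d\xi ,$$ and $$\mathrm{WF}(u_x)=\{(\pm x,\xi):\xi>0\},\qquad \mathrm{WF}(v_x)=\{(\pm x/\gamma,\xi):\xi>0\}.$$ -/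

import Mathlib

open Filter Topology MeasureTheory TopologicalSpace
open scoped ContDiff Distributions

namespace Microlocal

section General

variable {E : Type*} [NormedAddCommGroup E] [NormedSpace ℝ E]

/-- The product of a real test function with a smooth function. -/
noncomputable def mulSmooth (φ : 𝓓((⊤ : Opens E), ℝ)) (g : E → ℝ) (hg : ContDiff ℝ ∞ g) :
    𝓓((⊤ : Opens E), ℝ) where
  toFun x := φ x * g x
  contDiff' := φ.contDiff.mul hg
  hasCompactSupport' := φ.hasCompactSupport.mul_right
  tsupport_subset' := fun _ _ => trivial

/-- The Fourier transform `ξ ↦ ⟨u, φ e^{-i⟨·, ξ⟩}⟩` of the compactly supported distribution `φ u`,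
as a function of the covector `ξ`.  A complex distribution in the sense of Mathlib acts on real
test functions, so the exponential is split into its real part and its imaginary part. -/
noncomputable def localFourier (u : 𝓓'((⊤ : Opens E), ℂ)) (φ : 𝓓((⊤ : Opens E), ℝ))
    (ξ : StrongDual ℝ E) : ℂ :=
  u (mulSmooth φ (fun x => Real.cos (ξ x)) (Real.contDiff_cos.comp ξ.contDiff))
    - Complex.I * u (mulSmooth φ (fun x => Real.sin (ξ x)) (Real.contDiff_sin.comp ξ.contDiff))

/-- A set of covectors that is stable under multiplication by positive scalars. -/
def IsConic (V : Set (StrongDual ℝ E)) : Prop :=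
  ∀ ξ ∈ V, ∀ t : ℝ, 0 < t → t • ξ ∈ V

/-- The wave front set: `(x, ξ)` with `ξ ≠ 0` is outside it if and only if there are a test
function `φ` with `φ x ≠ 0` and an open conic neighbourhood `V` of `ξ` such that the Fourier
transform of `φ u` decays rapidly in `V`. -/
def waveFrontSet (u : 𝓓'((⊤ : Opens E), ℂ)) : Set (E × StrongDual ℝ E) :=
  {p | p.2 ≠ 0 ∧
    ¬ ∃ φ : 𝓓((⊤ : Opens E), ℝ), φ p.1 ≠ 0 ∧
      ∃ V : Set (StrongDual ℝ E), IsOpen V ∧ IsConic V ∧ p.2 ∈ V ∧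
        ∀ N : ℕ, ∃ C : ℝ, ∀ ξ ∈ V, (1 + ‖ξ‖) ^ N * ‖localFourier u φ ξ‖ ≤ C}

/-- `Γ` is a closed conic subset of the cotangent bundle of `E` with the zero section removed. -/
structure IsClosedConic (Γ : Set (E × StrongDual ℝ E)) : Prop where
  ne_zero : ∀ p ∈ Γ, p.2 ≠ 0
  smul_mem : ∀ p ∈ Γ, ∀ t : ℝ, 0 < t → (p.1, t • p.2) ∈ Γ
  closed : ∀ p ∈ closure Γ, p.2 ≠ 0 → p ∈ Γ

/-- Convergence of a sequence of distributions to `u` in the space of distributions with wave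
front set in `Γ`: weak convergence, and uniform convergence faster than any power of the
localized Fourier transforms in every closed cone `V` with `Γ ∩ (supp φ × V) = ∅`. -/
structure TendstoInCone (Γ : Set (E × StrongDual ℝ E)) (uj : ℕ → 𝓓'((⊤ : Opens E), ℂ))
    (u : 𝓓'((⊤ : Opens E), ℂ)) : Prop where
  waveFrontSet_seq_subset : ∀ j, waveFrontSet (uj j) ⊆ Γ
  waveFrontSet_subset : waveFrontSet u ⊆ Γ
  weak : ∀ g : 𝓓((⊤ : Opens E), ℝ), Tendsto (fun j => uj j g) atTop (𝓝 (u g))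
  fourier : ∀ (φ : 𝓓((⊤ : Opens E), ℝ)) (V : Set (StrongDual ℝ E)), IsClosed V → IsConic V →
    (∀ x ∈ tsupport φ, ∀ ξ ∈ V, (x, ξ) ∉ Γ) →
    ∀ (N : ℕ) (ε : ℝ), 0 < ε → ∀ᶠ j in atTop, ∀ ξ ∈ V,
      ‖ξ‖ ^ N * ‖localFourier (uj j) φ ξ - localFourier u φ ξ‖ ≤ ε

/-- The distribution `g ↦ ∫ g h` given by a (locally integrable) function `h`. -/
noncomputable def ofFunction [MeasureSpace E] [OpensMeasurableSpace E] (h : E → ℂ) :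
    𝓓'((⊤ : Opens E), ℂ) :=
  TestFunction.integralAgainstBilinCLM (ContinuousLinearMap.lsmul ℝ ℝ) volume h

/-- `w` is the pullback `f^* u` of `u` by the smooth map `f`, for `u` with wave front set in a
closed conic set `Γ` that contains no conormal of `f` (no covector `η` at `f y` with
`ᵗf'(y) η = 0`): the limit of `hⱼ ∘ f` for smooth functions `hⱼ` that converge to `u`
in the space of distributions with wave front set in `Γ`. -/
def IsPullback {E' : Type*} [NormedAddCommGroup E'] [NormedSpace ℝ E']
    [MeasureSpace E] [OpensMeasurableSpace E] [MeasureSpace E'] [OpensMeasurableSpace E']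
    (f : E' → E) (u : 𝓓'((⊤ : Opens E), ℂ)) (w : 𝓓'((⊤ : Opens E'), ℂ)) : Prop :=
  ∃ Γ : Set (E × StrongDual ℝ E), IsClosedConic Γ ∧
    (∀ (y : E') (η : StrongDual ℝ E), (f y, η) ∈ Γ → η ∘L fderiv ℝ f y ≠ 0) ∧
    ∃ h : ℕ → E → ℂ, (∀ j, ContDiff ℝ ∞ (h j)) ∧
      TendstoInCone Γ (fun j => ofFunction (h j)) u ∧
      ∀ g : 𝓓((⊤ : Opens E'), ℝ),
        Tendsto (fun j => ofFunction (h j ∘ f) g) atTop (𝓝 (w g))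

/-- `u` is the oscillatory integral `∫ e^{iφ(x,θ)} a(x,θ) dθ`, in the sense of the limit
`⟨u, g⟩ = lim_{ε → 0+} ∫∫ e^{iφ(x,θ)} a(x,θ) ψ(εθ) g(x) dx dθ` for every cut-off function `ψ`
that is smooth, compactly supported, and equal to `1` near `0`. -/
def IsOscillatoryIntegral {F : Type*} [NormedAddCommGroup F] [NormedSpace ℝ F]
    [MeasureSpace E] [MeasureSpace F] (phase : E → F → ℝ) (a : E → F → ℂ)
    (u : 𝓓'((⊤ : Opens E), ℂ)) : Prop :=
  ∀ ψ : 𝓓((⊤ : Opens F), ℝ), (∀ᶠ θ in 𝓝 (0 : F), ψ θ = 1) → ∀ g : 𝓓((⊤ : Opens E), ℝ),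
    Tendsto
      (fun ε : ℝ => ∫ θ : F, ∫ x : E,
        Complex.exp (Complex.I * (phase x θ : ℂ)) * a x θ * (ψ (ε • θ) : ℂ) * (g x : ℂ))
      (𝓝[>] 0) (𝓝 (u g))

/-- An oscillatory integral determines the distribution. -/
theorem IsOscillatoryIntegral.unique {F : Type*} [NormedAddCommGroup F] [NormedSpace ℝ F]
    [FiniteDimensional ℝ F] [MeasureSpace E] [MeasureSpace F] {phase : E → F → ℝ}
    {a : E → F → ℂ} {u u' : 𝓓'((⊤ : Opens E), ℂ)} (hu : IsOscillatoryIntegral phase a u)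
    (hu' : IsOscillatoryIntegral phase a u') : u = u' := by
  let b : ContDiffBump (0 : F) := ⟨1, 2, one_pos, one_lt_two⟩
  let ψ : 𝓓((⊤ : Opens F), ℝ) := ⟨b, b.contDiff, b.hasCompactSupport, fun _ _ => trivial⟩
  have hψ : ∀ᶠ θ in 𝓝 (0 : F), ψ θ = 1 := b.eventuallyEq_one
  ext g
  exact tendsto_nhds_unique (hu ψ hψ g) (hu' ψ hψ g)

end General

/-- The covector `ξ dx + τ dt` on the plane with coordinates `(x, t)`. -/
noncomputable def covector (ξ τ : ℝ) : StrongDual ℝ (ℝ × ℝ) :=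
  ξ • ContinuousLinearMap.fst ℝ ℝ ℝ + τ • ContinuousLinearMap.snd ℝ ℝ ℝ

/-- The covector `τ dt` on the line. -/
noncomputable def covectorLine (τ : ℝ) : StrongDual ℝ ℝ :=
  τ • ContinuousLinearMap.id ℝ ℝ

/-- The embedding `t ↦ (x, t)` of the line onto `{x} × ℝ`. -/
def timeLine (x : ℝ) : ℝ → ℝ × ℝ := fun t => (x, t)

end Microlocal

namespace Microlocal

/-! Splitting the integral at `ξ = 0` and putting `η = |ξ|` turns each distribution into a sum of
two waves `∫ a(η) e^{iη(ℓ(p) + s)} dη`, where `a` is supported in some `[r, ∞)` with `r > 0` and is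
a constant multiple of `1/η` for large `η`. In the plane `ℓ` is `dt ∓ dx/γ` with `s = 0`; on the
line `ℓ = dt` and `s = ∓x/γ`. The case `γ = 1` is `u`. The Fourier transform of `φ` times a wave is
`∫ a(η) e^{iηs} φ^(ζ - ηℓ) dη` (`wavePairing`), and every claim is an estimate of this absolutely
convergent integral.

Upper bound for the wave front set: if `ζ` stays in a cone away from the ray of `ℓ`, then `‖ζ - ηℓ‖`
dominates both `‖ζ‖` and `η` (`wavePairing_decay_of_separated`). If `ℓ + s` has no zero on the
support of `φ`, integration by parts in `η` replaces `a` by a high derivative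
(`wavePairing_decay_of_support`).

Lower bound: along `ζ = τℓ + ξ` the pairing times `τ e^{-iτs}` tends to a nonzero constant times an
integral of `φ^` over a line (`tendsto_wavePairing_ray`). In the plane the second wave decays near
that ray, so rapid decay of the sum forces these line integrals to vanish for all `ξ = ρ dx`, and by
Fourier inversion `φ` vanishes on the line `ℓ = 0`. On the line both waves share the covector `dt`,
but their limits oscillate as `e^{∓iτy}`, `y = x/γ`, and cannot cancel unless `φ(y) = φ(-y) = 0`.

Restriction: subtracting from `a` a tail `ρ_j` that lives on `[j + 1, ∞)`, with symbol constants
independent of `j`, leaves a compactly supported amplitude and hence a smooth function. Both decay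
estimates carry a factor `1/(j + 1)` for the tail, which gives convergence in the space attached to
the wave front set (`tendstoInCone_oscSum`), and these functions restrict to the approximants of the
one-dimensional wave. Uniqueness holds because the restriction of a smooth function is an integral
of its localized Fourier transform over the conormals of the line, where convergence is uniform and
rapid (`isPullback_timeLine_unique`). -/

/-- The unimodular exponential `x ↦ e^{ix}`. -/
noncomputable def expI (x : ℝ) : ℂ := Complex.exp (x * Complex.I)

theorem expI_add (x y : ℝ) : expI (x + y) = expI x * expI y := by
  simp [expI, add_mul, Complex.exp_add]

@[simp] theorem expI_zero : expI 0 = 1 := by simp [expI]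

@[simp] theorem norm_expI (x : ℝ) : ‖expI x‖ = 1 := Complex.norm_exp_ofReal_mul_I x

theorem contDiff_expI : ContDiff ℝ ∞ expI :=
  (Complex.ofRealCLM.contDiff.mul contDiff_const).cexp

@[fun_prop] theorem continuous_expI : Continuous expI := contDiff_expI.continuous

theorem hasDerivAt_expI (x : ℝ) : HasDerivAt expI (Complex.I * expI x) x := by
  have h : HasDerivAt (fun y : ℝ => (y : ℂ) * Complex.I) (1 * Complex.I) x :=
    (Complex.ofRealCLM.hasDerivAt (x := x)).mul_const _
  convert! h.cexp using 1
  simp [expI, mul_comm]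

theorem expI_neg_eq (x : ℝ) : expI (-x) = (Real.cos x : ℂ) - Complex.I * (Real.sin x : ℂ) := by
  rw [expI, Complex.exp_mul_I]
  push_cast
  rw [Complex.cos_neg, Complex.sin_neg]
  ring

/-! ### Fourier transforms of test functions, as functions of the covector. -/

section FourierAt

variable {E : Type*} [NormedAddCommGroup E] [NormedSpace ℝ E] [MeasureSpace E]

/-- The Fourier transform `ζ ↦ ∫ φ(p) e^{-i⟨p, ζ⟩} dp` as a function of the covector. -/
noncomputable def fourierAt (φ : E → ℂ) (ζ : StrongDual ℝ E) : ℂ :=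
  ∫ p, φ p * expI (-(ζ p))

theorem fourierAt_eq_vectorFourier [BorelSpace E] (φ : E → ℂ) (ζ : StrongDual ℝ E) :
    fourierAt φ ζ = VectorFourier.fourierIntegral Real.fourierChar volume
      (ContinuousLinearMap.id ℝ (StrongDual ℝ E)).flip.toLinearMap₁₂ φ ((2 * Real.pi)⁻¹ • ζ) := by
  simp only [fourierAt, VectorFourier.fourierIntegral]
  refine integral_congr_ae (Eventually.of_forall fun p => ?_)
  simp only [Circle.smul_def, smul_eq_mul, Real.fourierChar_apply, expI, mul_comm (φ p)]
  congr 2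
  simp
  field_simp

theorem continuous_fourierAt [BorelSpace E] [FiniteDimensional ℝ E] {φ : E → ℂ}
    (hφ : Integrable φ) : Continuous (fourierAt φ) := by
  have := VectorFourier.fourierIntegral_continuous (μ := volume) (f := φ)
    (L := (ContinuousLinearMap.id ℝ (StrongDual ℝ E)).flip.toLinearMap₁₂)
    Real.continuous_fourierChar (by
      simpa using! (isBoundedBilinearMap_apply (𝕜 := ℝ) (E := E) (F := ℝ)).continuous.comp
        continuous_swap) hφ
  rw [show fourierAt φ = _ from funext (fourierAt_eq_vectorFourier φ)]
  exact this.comp (continuous_const_smul _)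

variable [BorelSpace E] [FiniteDimensional ℝ E] [(volume : Measure E).IsAddHaarMeasure]

/-- The Fourier transform of a compactly supported smooth function decays rapidly. -/
theorem fourierAt_decay {φ : E → ℂ} (hφ : ContDiff ℝ ∞ φ) (hc : HasCompactSupport φ) (N : ℕ) :
    ∃ C : ℝ, 0 ≤ C ∧ ∀ ζ, (1 + ‖ζ‖) ^ N * ‖fourierAt φ ζ‖ ≤ C := by
  have hint : ∀ k n : ℕ, Integrable (fun v : E => ‖v‖ ^ k * ‖iteratedFDeriv ℝ n φ v‖) := by
    intro k n
    refine Continuous.integrable_of_hasCompactSupport ?_ ?_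
    · exact (continuous_norm.pow k).mul
        (hφ.continuous_iteratedFDeriv (by exact_mod_cast le_top)).norm
    · exact (hc.iteratedFDeriv n).norm.mul_left
  have key : ∀ n : ℕ, ∃ C : ℝ, 0 ≤ C ∧ ∀ ζ, ‖ζ‖ ^ n * ‖fourierAt φ ζ‖ ≤ C := by
    intro n
    set S : ℝ := 2 ^ n * ∑ p ∈ Finset.range 1 ×ˢ Finset.range (n + 1),
      ∫ v : E, ‖v‖ ^ p.1 * ‖iteratedFDeriv ℝ p.2 φ v‖ with hS
    have hS0 : 0 ≤ S := mul_nonneg (by positivity)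
      (Finset.sum_nonneg fun p _ => integral_nonneg fun v => by positivity)
    -- One factor `2` pays for testing `ζ` on a vector that attains only half its norm, and `2π` for
    -- the normalization of the frequency.
    refine ⟨(2 * (2 * Real.pi)) ^ n * S, by positivity, fun ζ => ?_⟩
    have h1 := fun v : E => VectorFourier.pow_mul_norm_iteratedFDeriv_fourierIntegral_le
      (μ := volume) (f := φ) (K := ⊤) (N := ⊤)
      (ContinuousLinearMap.id ℝ (StrongDual ℝ E)).flip hφ (fun k n _ _ => hint k n)
      (k := 0) (n := n) le_top le_top v ((2 * Real.pi)⁻¹ • ζ)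
    simp only [norm_iteratedFDeriv_zero, ← fourierAt_eq_vectorFourier] at h1
    have h2 : ∀ v : E, |ζ v| ^ n * ‖fourierAt φ ζ‖ ≤ ‖v‖ ^ n * ((2 * Real.pi) ^ n * S) := by
      intro v
      have h3 : |ζ v| ^ n = (2 * Real.pi) ^ n *
          |((ContinuousLinearMap.id ℝ (StrongDual ℝ E)).flip v) ((2 * Real.pi)⁻¹ • ζ)| ^ n := by
        rw [← mul_pow]
        simp [abs_mul, abs_of_pos Real.pi_pos]
        field_simp
      rw [h3, mul_assoc, mul_left_comm (‖v‖ ^ n)]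
      refine mul_le_mul_of_nonneg_left ((h1 v).trans (le_of_eq ?_)) (by positivity)
      simp only [hS]
      norm_num
      ring
    obtain ⟨v, hv1, hv2⟩ : ∃ v : E, ‖v‖ ≤ 1 ∧ ‖ζ‖ / 2 ≤ |ζ v| := by
      rcases eq_or_ne ζ 0 with rfl | hζ
      · exact ⟨0, by simp, by simp⟩
      · obtain ⟨v, hv1, hv2⟩ := ζ.exists_lt_apply_of_lt_opNorm
          (half_lt_self (norm_pos_iff.mpr hζ))
        exact ⟨v, hv1.le, hv2.le⟩
    calc ‖ζ‖ ^ n * ‖fourierAt φ ζ‖ = 2 ^ n * ((‖ζ‖ / 2) ^ n * ‖fourierAt φ ζ‖) := by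
          rw [← mul_assoc, ← mul_pow, mul_div_cancel₀ _ two_ne_zero]
      _ ≤ 2 ^ n * (|ζ v| ^ n * ‖fourierAt φ ζ‖) := by gcongr
      _ ≤ 2 ^ n * (1 ^ n * ((2 * Real.pi) ^ n * S)) := by
          refine mul_le_mul_of_nonneg_left ((h2 v).trans ?_) (by positivity)
          gcongr
      _ = _ := by rw [one_pow, one_mul, mul_pow 2 (2 * Real.pi), mul_assoc]
  obtain ⟨C₀, hC₀, h₀⟩ := key 0
  obtain ⟨C₁, hC₁, h₁⟩ := key N
  refine ⟨2 ^ N * (C₀ + C₁), by positivity, fun ζ => ?_⟩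
  have h : (1 + ‖ζ‖) ^ N ≤ 2 ^ N * (1 + ‖ζ‖ ^ N) := by
    rcases le_total ‖ζ‖ 1 with h | h
    · calc (1 + ‖ζ‖) ^ N ≤ 2 ^ N := by gcongr; linarith
        _ ≤ _ := le_mul_of_one_le_right (by positivity) (by simp)
    · calc (1 + ‖ζ‖) ^ N ≤ (2 * ‖ζ‖) ^ N := by gcongr; linarith
        _ ≤ _ := by rw [mul_pow]; gcongr; simp
  calc (1 + ‖ζ‖) ^ N * ‖fourierAt φ ζ‖ ≤ 2 ^ N * (1 + ‖ζ‖ ^ N) * ‖fourierAt φ ζ‖ := by gcongr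
    _ = 2 ^ N * (‖ζ‖ ^ 0 * ‖fourierAt φ ζ‖ + ‖ζ‖ ^ N * ‖fourierAt φ ζ‖) := by ring
    _ ≤ _ := by gcongr; exacts [h₀ ζ, h₁ ζ]

end FourierAt

/-! ### Inversion on the line and superpositions of exponentials. -/

theorem integral_fourier_inversion {k : ℝ → ℂ} (hk : Continuous k) (hi : Integrable k)
    (hi' : Integrable fun σ : ℝ => ∫ s, k s * expI (-(σ * s))) (y : ℝ) :
    ∫ σ : ℝ, (∫ s, k s * expI (-(σ * s))) * expI (σ * y) = 2 * Real.pi * k y := by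
  have hF : ∀ v : ℝ, FourierTransform.fourier k v =
      ∫ s, k s * expI (-((v * (2 * Real.pi)) * s)) := by
    intro v
    rw [Real.fourier_real_eq_integral_exp_smul]
    refine integral_congr_ae (Eventually.of_forall fun s => ?_)
    simp only [expI, smul_eq_mul, mul_comm (k s)]
    congr 2
    push_cast
    ring
  have hpi : (2 * Real.pi) ≠ 0 := by positivity
  have hiF : Integrable (FourierTransform.fourier k) := by
    rw [show FourierTransform.fourier k = _ from funext hF]
    exact hi'.comp_mul_right' hpi
  have h := congrFun (hk.fourierInv_fourier_eq hi hiF) y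
  rw [Real.fourierInv_eq] at h
  rw [← h]
  have h2 := Measure.integral_comp_mul_right
    (fun σ : ℝ => (∫ s, k s * expI (-(σ * s))) * expI (σ * y)) (2 * Real.pi)
  rw [abs_of_pos (by positivity), eq_comm, inv_smul_eq_iff₀ hpi] at h2
  rw [h2, Complex.real_smul]
  push_cast
  congr 1
  refine integral_congr_ae (Eventually.of_forall fun v => ?_)
  simp only [hF, Circle.smul_def, smul_eq_mul, Real.fourierChar_apply, expI]
  rw [mul_comm]
  congr 2
  simp
  ring

/-- The function `y ↦ ∫ b(η) e^{iηy} dη`. -/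
noncomputable def oscFun (b : ℝ → ℂ) (y : ℝ) : ℂ := ∫ η, b η * expI (η * y)

theorem continuous_oscFun {b : ℝ → ℂ} (hb : Integrable b) : Continuous (oscFun b) := by
  refine continuous_of_dominated (bound := fun η => ‖b η‖) (fun y => ?_) (fun y => ?_) hb.norm ?_
  · exact hb.1.mul (by fun_prop : Continuous fun η : ℝ => expI (η * y)).aestronglyMeasurable
  · exact Eventually.of_forall fun η => by simp
  · exact Eventually.of_forall fun η => by fun_prop

/-- All moments of a compactly supported amplitude are integrable, so its Fourier transform can be
differentiated indefinitely. -/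
theorem contDiff_oscFun {b : ℝ → ℂ} (hb : Continuous b) (hc : HasCompactSupport b) :
    ContDiff ℝ ∞ (oscFun b) := by
  have h : oscFun b = fun y => FourierTransform.fourier b (-((2 * Real.pi)⁻¹ * y)) := by
    funext y
    rw [Real.fourier_real_eq_integral_exp_smul]
    refine integral_congr_ae (Eventually.of_forall fun s => ?_)
    simp only [expI, smul_eq_mul, mul_comm (b s)]
    congr 2
    push_cast
    field_simp
  rw [h]
  refine (Real.contDiff_fourier (N := ⊤) fun n _ => ?_).comp (contDiff_const.mul contDiff_id).neg
  exact ((continuous_norm.pow n).mul hb.norm).integrable_of_hasCompactSupport hc.norm.mul_left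

/-! ### The localized Fourier transform of a wave as an integral over the frequency. -/

section Pairing

variable {E : Type*} [NormedAddCommGroup E] [NormedSpace ℝ E] [MeasureSpace E]

/-- The integral `∫ b(η) e^{iηs} φ^(ζ - ηℓ) dη`, which is the Fourier transform at `ζ` of the
product of `φ` and `p ↦ ∫ b(η) e^{iη(ℓ(p) + s)} dη`. -/
noncomputable def wavePairing (b : ℝ → ℂ) (ℓ : StrongDual ℝ E) (s : ℝ) (φ : E → ℂ)
    (ζ : StrongDual ℝ E) : ℂ :=
  ∫ η : ℝ, b η * (expI (η * s) * fourierAt φ (ζ - η • ℓ))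

theorem expI_mul_fourierAt (ℓ : StrongDual ℝ E) (s : ℝ) (φ : E → ℂ) (ζ : StrongDual ℝ E) (η : ℝ) :
    expI (η * s) * fourierAt φ (ζ - η • ℓ) =
      ∫ p, φ p * expI (-(ζ p)) * expI (η * (ℓ p + s)) := by
  rw [fourierAt, ← integral_const_mul]
  refine integral_congr_ae (Eventually.of_forall fun p => ?_)
  simp only
  rw [mul_left_comm, mul_assoc, ← expI_add, ← expI_add]
  congr 2
  simp
  ring

theorem integral_expI_eq_cutoff (phase : E → ℝ) (A c : ℂ) {ℓ : StrongDual ℝ E} {s η : ℝ}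
    (hphase : ∀ p, phase p = η * (ℓ p + s)) (g : 𝓓((⊤ : Opens E), ℝ)) :
    ∫ x, Complex.exp (Complex.I * (phase x : ℂ)) * A * c * (g x : ℂ) =
      A * c * (expI (η * s) * fourierAt (fun p => (g p : ℂ)) (0 - η • ℓ)) := by
  rw [expI_mul_fourierAt, ← integral_const_mul]
  refine integral_congr_ae (Eventually.of_forall fun p => ?_)
  simp only [hphase, zero_apply, neg_zero, expI_zero, mul_one]
  rw [expI, mul_comm Complex.I]
  ring

variable [BorelSpace E] [FiniteDimensional ℝ E] [(volume : Measure E).IsAddHaarMeasure]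

/-- Fubini. The right-hand side also makes sense for bounded `b`, where the left-hand side need not;
this is how waves are handled later. -/
theorem integral_mul_oscFun {b : ℝ → ℂ} (hb : Integrable b) (ℓ : StrongDual ℝ E) (s : ℝ)
    {φ : E → ℂ} (hφ : Integrable φ) (ζ : StrongDual ℝ E) :
    ∫ p, φ p * expI (-(ζ p)) * oscFun b (ℓ p + s) = wavePairing b ℓ s φ ζ := by
  simp only [wavePairing, expI_mul_fourierAt, oscFun, ← integral_const_mul]
  rw [integral_integral_swap]
  · refine integral_congr_ae (Eventually.of_forall fun η => integral_congr_ae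
      (Eventually.of_forall fun p => ?_))
    simp only
    ring
  · have h := hφ.mul_prod hb
    refine (h.bdd_mul (c := 1) (f := fun z : E × ℝ => expI (-(ζ z.1)) * expI (z.2 * (ℓ z.1 + s)))
      (by fun_prop : Continuous _).aestronglyMeasurable
      (Eventually.of_forall fun z => by simp)).congr (Eventually.of_forall fun z => ?_)
    simp only [Function.uncurry]
    ring

theorem ofFunction_apply {h : E → ℂ} (hh : Continuous h) (g : 𝓓((⊤ : Opens E), ℝ)) :
    ofFunction h g = ∫ p, (g p : ℂ) * h p := by
  refine (TestFunction.integralAgainstBilinCLM_eq_integral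
    (hh.locallyIntegrable.locallyIntegrableOn _)).trans ?_
  simp

theorem ofFunction_oscFun_apply {b : ℝ → ℂ} (hb : Integrable b) (ℓ : StrongDual ℝ E) (s : ℝ)
    (g : 𝓓((⊤ : Opens E), ℝ)) :
    ofFunction (fun p => oscFun b (ℓ p + s)) g = wavePairing b ℓ s (fun p => (g p : ℂ)) 0 := by
  rw [ofFunction_apply (h := fun p => oscFun b (ℓ p + s)) ((continuous_oscFun hb).comp
    (by fun_prop : Continuous fun p => ℓ p + s)), ← integral_mul_oscFun hb]
  · simp
  · exact (Complex.continuous_ofReal.comp g.continuous).integrable_of_hasCompactSupport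
      (g.hasCompactSupport.comp_left Complex.ofReal_zero)

end Pairing

section Pairing

variable {E : Type*} [NormedAddCommGroup E] [NormedSpace ℝ E]

theorem contDiff_ofReal_testFunction (g : 𝓓((⊤ : Opens E), ℝ)) :
    ContDiff ℝ ∞ fun p => (g p : ℂ) := Complex.ofRealCLM.contDiff.comp g.contDiff

theorem hasCompactSupport_ofReal_testFunction (g : 𝓓((⊤ : Opens E), ℝ)) :
    HasCompactSupport fun p => (g p : ℂ) := g.hasCompactSupport.comp_left Complex.ofReal_zero

variable [MeasureSpace E] [BorelSpace E] [(volume : Measure E).IsAddHaarMeasure]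

theorem hasDerivAt_expI_mul_fourierAt {φ : E → ℂ} (hφ : ContDiff ℝ ∞ φ) (hc : HasCompactSupport φ)
    (ℓ : StrongDual ℝ E) (s : ℝ) (ζ : StrongDual ℝ E) (η : ℝ) :
    HasDerivAt (fun η : ℝ => expI (η * s) * fourierAt φ (ζ - η • ℓ))
      (Complex.I * (expI (η * s) * fourierAt (fun p => ((ℓ p + s : ℝ) : ℂ) * φ p) (ζ - η • ℓ)))
      η := by
  simp only [expI_mul_fourierAt]
  have hcont : Continuous fun p => φ p * expI (-(ζ p)) :=
    hφ.continuous.mul (by fun_prop)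
  have hcs : HasCompactSupport fun p => φ p * expI (-(ζ p)) := hc.mul_right
  have hcl : Continuous fun p => ((ℓ p + s : ℝ) : ℂ) :=
    Complex.continuous_ofReal.comp (by fun_prop)
  have h := hasDerivAt_integral_of_dominated_loc_of_deriv_le (μ := (volume : Measure E))
    (F := fun η p => φ p * expI (-(ζ p)) * expI (η * (ℓ p + s)))
    (F' := fun η p => φ p * expI (-(ζ p)) *
      (((ℓ p + s : ℝ) : ℂ) * (Complex.I * expI (η * (ℓ p + s)))))
    (x₀ := η) (s := Set.univ) (bound := fun p => ‖φ p * expI (-(ζ p)) * ((ℓ p + s : ℝ) : ℂ)‖)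
    univ_mem ?_ ?_ ?_ ?_ ?_ ?_
  · convert! h.2 using 1
    rw [← integral_const_mul]
    refine integral_congr_ae (Eventually.of_forall fun p => ?_)
    simp only
    ring
  · exact Eventually.of_forall fun x => (hcont.mul (by fun_prop)).aestronglyMeasurable
  · exact (hcont.mul (by fun_prop)).integrable_of_hasCompactSupport hcs.mul_right
  · exact (hcont.mul (hcl.mul (by fun_prop))).aestronglyMeasurable
  · exact Eventually.of_forall fun p x _ => by simp
  · exact ((hcont.mul hcl).integrable_of_hasCompactSupport hcs.mul_right).norm
  · refine Eventually.of_forall fun p x _ => ?_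
    have := (hasDerivAt_expI (x * (ℓ p + s))).scomp x ((hasDerivAt_id x).mul_const (ℓ p + s))
    convert! this.const_mul (φ p * expI (-(ζ p))) using 1
    simp

variable [FiniteDimensional ℝ E]

theorem fourierAt_fderiv {φ : E → ℂ} (hφ : ContDiff ℝ ∞ φ) (hc : HasCompactSupport φ)
    (ζ : StrongDual ℝ E) (e : E) :
    fourierAt (fun p => fderiv ℝ φ p e) ζ = Complex.I * ζ e * fourierAt φ ζ := by
  have hd : ∀ p, HasFDerivAt (fun p => expI (-(ζ p)))
      ((Complex.I * expI (-(ζ p))) • (Complex.ofRealCLM ∘L (-ζ))) p := by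
    intro p
    have := (hasDerivAt_expI (-(ζ p))).hasFDerivAt.comp p (-ζ).hasFDerivAt
    convert! this using 1
    ext v
    simp
    ring
  have hφ' : Continuous fun p => fderiv ℝ φ p e :=
    (hφ.continuous_fderiv (by simp)).clm_apply continuous_const
  have hc' : HasCompactSupport fun p => fderiv ℝ φ p e := hc.fderiv_apply ℝ e
  have hce : Continuous fun p => expI (-(ζ p)) := by fun_prop
  have hf : ∀ p, fderiv ℝ (fun p => expI (-(ζ p))) p e = -(Complex.I * ζ e) * expI (-(ζ p)) := by
    intro p
    rw [(hd p).fderiv]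
    simp
    ring
  have h := integral_mul_fderiv_eq_neg_fderiv_mul_of_integrable (μ := (volume : Measure E))
    (f := fun p => expI (-(ζ p))) (g := φ) (v := e) ?_ ?_ ?_
    (fun p _ => (hd p).differentiableAt) (fun p _ => (hφ.differentiable (by simp)).differentiableAt)
  · simp only [hf] at h
    simp only [fourierAt, mul_comm _ (expI _)]
    rw [h, ← integral_neg, ← integral_const_mul]
    refine integral_congr_ae (Eventually.of_forall fun p => ?_)
    simp only
    ring
  · simp only [hf]
    exact ((continuous_const.mul hce).mul hφ.continuous).integrable_of_hasCompactSupport hc.mul_left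
  · exact (hce.mul hφ').integrable_of_hasCompactSupport hc'.mul_left
  · exact (hce.mul hφ.continuous).integrable_of_hasCompactSupport hc.mul_left

/-- Since `ℓ ≠ 0`, `‖ζ - ηℓ‖ ≥ |η| ‖ℓ‖ - ‖ζ‖`, so decay in the covector becomes decay in `η`. -/
theorem fourierAt_decay_line {φ : E → ℂ} (hφ : ContDiff ℝ ∞ φ) (hc : HasCompactSupport φ)
    {ℓ : StrongDual ℝ E} (hℓ : ℓ ≠ 0) (ζ : StrongDual ℝ E) (N : ℕ) :
    ∃ C : ℝ, 0 ≤ C ∧ ∀ η : ℝ, (1 + |η|) ^ N * ‖fourierAt φ (ζ - η • ℓ)‖ ≤ C := by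
  obtain ⟨C, hC, h⟩ := fourierAt_decay hφ hc N
  have hℓ' : 0 < ‖ℓ‖ := norm_pos_iff.mpr hℓ
  refine ⟨(1 + (1 + ‖ζ‖) / ‖ℓ‖) ^ N * C, by positivity, fun η => ?_⟩
  have h1 : |η| * ‖ℓ‖ ≤ ‖ζ - η • ℓ‖ + ‖ζ‖ := by
    have := norm_sub_le (ζ - η • ℓ) ζ
    rwa [sub_sub_cancel_left, norm_neg, norm_smul, Real.norm_eq_abs] at this
  have h2 : 1 + |η| ≤ (1 + (1 + ‖ζ‖) / ‖ℓ‖) * (1 + ‖ζ - η • ℓ‖) := by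
    have h3 : |η| ≤ (‖ζ - η • ℓ‖ + ‖ζ‖) / ‖ℓ‖ := by rwa [le_div_iff₀ hℓ']
    have h4 : ‖ζ - η • ℓ‖ + ‖ζ‖ ≤ (1 + ‖ζ‖) * (1 + ‖ζ - η • ℓ‖) := by
      nlinarith [norm_nonneg ζ, norm_nonneg (ζ - η • ℓ)]
    have h5 := div_le_div_of_nonneg_right h4 hℓ'.le
    have h6 : (1 + ‖ζ‖) * (1 + ‖ζ - η • ℓ‖) / ‖ℓ‖ = (1 + ‖ζ‖) / ‖ℓ‖ * (1 + ‖ζ - η • ℓ‖) := by ring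
    nlinarith [norm_nonneg (ζ - η • ℓ)]
  calc (1 + |η|) ^ N * ‖fourierAt φ (ζ - η • ℓ)‖
      ≤ ((1 + (1 + ‖ζ‖) / ‖ℓ‖) * (1 + ‖ζ - η • ℓ‖)) ^ N * ‖fourierAt φ (ζ - η • ℓ)‖ := by gcongr
    _ = (1 + (1 + ‖ζ‖) / ‖ℓ‖) ^ N * ((1 + ‖ζ - η • ℓ‖) ^ N * ‖fourierAt φ (ζ - η • ℓ)‖) := by
        rw [mul_pow, mul_assoc]
    _ ≤ _ := by
        refine mul_le_mul_of_nonneg_left (h _) (by positivity)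

theorem continuous_fourierAt_line {φ : E → ℂ} (hφ : ContDiff ℝ ∞ φ) (hc : HasCompactSupport φ)
    (ℓ : StrongDual ℝ E) (ζ : StrongDual ℝ E) :
    Continuous fun η : ℝ => fourierAt φ (ζ - η • ℓ) :=
  (continuous_fourierAt (hφ.continuous.integrable_of_hasCompactSupport hc)).comp (by fun_prop)

theorem integrable_fourierAt_line {φ : E → ℂ} (hφ : ContDiff ℝ ∞ φ) (hc : HasCompactSupport φ)
    {ℓ : StrongDual ℝ E} (hℓ : ℓ ≠ 0) (ζ : StrongDual ℝ E) (N : ℕ) :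
    Integrable fun η : ℝ => (1 + |η|) ^ N * ‖fourierAt φ (ζ - η • ℓ)‖ := by
  obtain ⟨C, hC, h⟩ := fourierAt_decay_line hφ hc hℓ ζ (N + 2)
  refine (integrable_inv_one_add_sq.const_mul C).mono' ?_ (Eventually.of_forall fun η => ?_)
  · exact (((continuous_const.add continuous_abs).pow N).mul
      (continuous_fourierAt_line hφ hc ℓ ζ).norm).aestronglyMeasurable
  · rw [Real.norm_of_nonneg (by positivity), ← div_eq_mul_inv, le_div_iff₀ (by positivity)]
    refine le_trans ?_ (h η)
    rw [pow_add, mul_right_comm]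
    gcongr
    nlinarith [abs_nonneg η, sq_abs η]

theorem integrable_wave {φ : E → ℂ} (hφ : ContDiff ℝ ∞ φ) (hc : HasCompactSupport φ)
    {ℓ : StrongDual ℝ E} (hℓ : ℓ ≠ 0) (ζ : StrongDual ℝ E) (s : ℝ) {b : ℝ → ℂ}
    (hb : AEStronglyMeasurable b) {K : ℝ} (hK : ∀ η, ‖b η‖ ≤ K) :
    Integrable fun η : ℝ => b η * (expI (η * s) * fourierAt φ (ζ - η • ℓ)) := by
  have h := (integrable_fourierAt_line hφ hc hℓ ζ 0).const_mul K
  refine h.mono' (hb.mul ((by fun_prop : Continuous fun η : ℝ => expI (η * s)).mul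
      (continuous_fourierAt_line hφ hc ℓ ζ)).aestronglyMeasurable)
    (Eventually.of_forall fun η => ?_)
  simp only [norm_mul, norm_expI, one_mul, pow_zero]
  exact mul_le_mul_of_nonneg_right (hK η) (norm_nonneg _)

/-- The `η`-derivative of `e^{iηs} φ^(ζ - ηℓ)` brings down `i(ℓ + s)` on `φ`; integration by parts
moves it to the amplitude. -/
theorem wavePairing_mul_phase {φ : E → ℂ} (hφ : ContDiff ℝ ∞ φ) (hc : HasCompactSupport φ)
    {ℓ : StrongDual ℝ E} (hℓ : ℓ ≠ 0) (s : ℝ) (ζ : StrongDual ℝ E) {b : ℝ → ℂ}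
    (hb : ContDiff ℝ ∞ b) {K K' : ℝ} (hK : ∀ η, ‖b η‖ ≤ K) (hK' : ∀ η, ‖deriv b η‖ ≤ K') :
    wavePairing b ℓ s (fun p => ((ℓ p + s : ℝ) : ℂ) * φ p) ζ =
      Complex.I * wavePairing (deriv b) ℓ s φ ζ := by
  have hφ' : ContDiff ℝ ∞ fun p => ((ℓ p + s : ℝ) : ℂ) * φ p :=
    (Complex.ofRealCLM.contDiff.comp (ℓ.contDiff.add contDiff_const)).mul hφ
  have hc' : HasCompactSupport fun p => ((ℓ p + s : ℝ) : ℂ) * φ p := hc.mul_left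
  have hi := integrable_wave hφ' hc' hℓ ζ s hb.continuous.aestronglyMeasurable hK
  have h := integral_mul_deriv_eq_deriv_mul_of_integrable
    (u := b) (v := fun η => expI (η * s) * fourierAt φ (ζ - η • ℓ)) (u' := deriv b)
    (fun η _ => (hb.differentiable (by simp)).differentiableAt.hasDerivAt)
    (fun η _ => hasDerivAt_expI_mul_fourierAt hφ hc ℓ s ζ η)
    ((hi.const_mul Complex.I).congr (Eventually.of_forall fun η => by simp; ring))
    (integrable_wave hφ hc hℓ ζ s (hb.continuous_deriv (by simp)).aestronglyMeasurable hK')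
    (integrable_wave hφ hc hℓ ζ s hb.continuous.aestronglyMeasurable hK)
  have h1 : Complex.I * wavePairing b ℓ s (fun p => ((ℓ p + s : ℝ) : ℂ) * φ p) ζ =
      -wavePairing (deriv b) ℓ s φ ζ := by
    rw [wavePairing, ← integral_const_mul]
    refine Eq.trans ?_ h
    refine integral_congr_ae (Eventually.of_forall fun η => ?_)
    simp only
    ring
  linear_combination (-Complex.I) * h1 + (wavePairing b ℓ s (fun p => ((ℓ p + s : ℝ) : ℂ) * φ p) ζ)
    * Complex.I_mul_I

/-- Repeated integration by parts: a test function supported away from the zero set of the phase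
allows one to replace the amplitude by its derivatives. -/
theorem exists_wavePairing_eq_iteratedDeriv {ℓ : StrongDual ℝ E} (hℓ : ℓ ≠ 0) (s : ℝ) (k : ℕ) :
    ∀ {φ : E → ℂ}, ContDiff ℝ ∞ φ → HasCompactSupport φ → (∀ p ∈ tsupport φ, ℓ p + s ≠ 0) →
    ∃ φ' : E → ℂ, ContDiff ℝ ∞ φ' ∧ HasCompactSupport φ' ∧
      ∀ b : ℝ → ℂ, ContDiff ℝ ∞ b → (∀ j, ∃ K, ∀ η, ‖iteratedDeriv j b η‖ ≤ K) → ∀ ζ,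
        wavePairing b ℓ s φ ζ = Complex.I ^ k * wavePairing (iteratedDeriv k b) ℓ s φ' ζ := by
  induction k with
  | zero => exact fun {φ} hφ hc _ => ⟨φ, hφ, hc, fun b _ _ ζ => by simp⟩
  | succ k ih =>
    intro φ hφ hc hs
    -- Dividing by the phase is harmless on the support of `φ`; each division buys one derivative of
    -- the amplitude.
    set ψ : E → ℂ := fun p => ((ℓ p + s : ℝ) : ℂ)⁻¹ * φ p with hψ
    have hsub : tsupport ψ ⊆ tsupport φ := tsupport_mul_subset_right
    have hψ1 : ContDiff ℝ ∞ ψ := by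
      refine contDiff_iff_contDiffAt.mpr fun p => ?_
      by_cases hp : p ∈ tsupport ψ
      swap
      · exact contDiffAt_const.congr_of_eventuallyEq (notMem_tsupport_iff_eventuallyEq.mp hp)
      refine ContDiffAt.mul (ContDiffAt.inv ?_ ?_) hφ.contDiffAt
      · exact (Complex.ofRealCLM.contDiff.comp (ℓ.contDiff.add contDiff_const)).contDiffAt
      · exact_mod_cast hs p (hsub hp)
    have hψ2 : HasCompactSupport ψ := hc.mul_left
    obtain ⟨φ', h1, h2, h3⟩ := ih hψ1 hψ2 fun p hp => hs p (hsub hp)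
    refine ⟨φ', h1, h2, fun b hb hK ζ => ?_⟩
    have hφψ : φ = fun p => ((ℓ p + s : ℝ) : ℂ) * ψ p := by
      funext p
      by_cases hp : p ∈ tsupport φ
      · have : ((ℓ p + s : ℝ) : ℂ) ≠ 0 := by exact_mod_cast hs p hp
        simp only [hψ]
        rw [mul_inv_cancel_left₀ this]
      · simp [hψ, image_eq_zero_of_notMem_tsupport hp]
    obtain ⟨K, hK0⟩ := hK 0
    obtain ⟨K', hK1⟩ := hK 1
    rw [hφψ, wavePairing_mul_phase hψ1 hψ2 hℓ s ζ hb (by simpa using hK0) (by simpa using hK1),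
      h3 (deriv b) (ContDiff.deriv' (n := ∞) (by simpa using hb)) (fun j => by simpa [← iteratedDeriv_succ'] using hK (j + 1)),
      iteratedDeriv_succ', pow_succ']
    ring

end Pairing

/-! ### Symbols of order `-1`. -/

/-- Classical symbol estimates of order `-1` for an amplitude supported in `[r, ∞)`. -/
structure IsSymbol (r : ℝ) (C : ℕ → ℝ) (b : ℝ → ℂ) : Prop where
  contDiff : ContDiff ℝ ∞ b
  eq_zero : ∀ η < r, b η = 0
  bound : ∀ k η, |η| ^ (k + 1) * ‖iteratedDeriv k b η‖ ≤ C k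

namespace IsSymbol

variable {r : ℝ} {C : ℕ → ℝ} {b : ℝ → ℂ}

theorem nonneg (h : IsSymbol r C b) (k : ℕ) : 0 ≤ C k :=
  le_trans (by positivity) (h.bound k 0)

theorem iteratedDeriv_eq_zero (h : IsSymbol r C b) (k : ℕ) {η : ℝ} (hη : η < r) :
    iteratedDeriv k b η = 0 := by
  have h1 : b =ᶠ[𝓝 η] fun _ => 0 := by
    filter_upwards [Iio_mem_nhds hη] with x hx using h.eq_zero x hx
  rw [h1.iteratedDeriv_eq k]
  simp

theorem norm_iteratedDeriv_le (h : IsSymbol r C b) (hr : 0 < r) (k : ℕ) (η : ℝ) :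
    ‖iteratedDeriv k b η‖ ≤ C k / r ^ (k + 1) := by
  rcases lt_or_ge η r with hη | hη
  · rw [h.iteratedDeriv_eq_zero k hη, norm_zero]
    exact div_nonneg (h.nonneg k) (by positivity)
  · rw [le_div_iff₀ (by positivity), mul_comm]
    refine le_trans ?_ (h.bound k η)
    gcongr
    exact hη.trans (le_abs_self η)

theorem norm_le (h : IsSymbol r C b) (hr : 0 < r) (η : ℝ) : ‖b η‖ ≤ C 0 / r := by
  simpa using h.norm_iteratedDeriv_le hr 0 η

end IsSymbol

theorem mul_rpow_neg_two_eq_div_sq (K : ℝ) {η : ℝ} (hη : 0 < η) :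
    K * η ^ (-2 : ℝ) = K / η ^ 2 := by
  rw [Real.rpow_neg hη.le, div_eq_mul_inv]
  norm_num

theorem integrableOn_div_sq {ρ : ℝ} (hρ : 0 < ρ) (K : ℝ) :
    IntegrableOn (fun η : ℝ => K / η ^ 2) (Set.Ici ρ) := by
  rw [integrableOn_Ici_iff_integrableOn_Ioi]
  have h : IntegrableOn (fun η : ℝ => K * η ^ (-2 : ℝ)) (Set.Ioi ρ) :=
    (integrableOn_Ioi_rpow_of_lt (by norm_num : (-2 : ℝ) < -1) hρ).const_mul K
  exact h.congr_fun (fun η hη => mul_rpow_neg_two_eq_div_sq K (hρ.trans hη)) measurableSet_Ioi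

/-- The integral of `K/η²` over `[ρ, ∞)` is `K/ρ`. The gain `1/ρ` is what later makes the
contribution of the tails tend to zero. -/
theorem norm_integral_le_div {f : ℝ → ℂ} {ρ K : ℝ} (hρ : 0 < ρ) (h0 : ∀ η < ρ, f η = 0)
    (h1 : ∀ η, ρ ≤ η → ‖f η‖ ≤ K / η ^ 2) : ‖∫ η, f η‖ ≤ K / ρ := by
  have hle : ‖∫ η, f η‖ ≤ ∫ η, (Set.Ici ρ).indicator (fun η => K / η ^ 2) η := by
    refine norm_integral_le_of_norm_le
      ((integrable_indicator_iff measurableSet_Ici).mpr (integrableOn_div_sq hρ K))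
      (Eventually.of_forall fun η => ?_)
    by_cases hη : ρ ≤ η
    · rw [Set.indicator_of_mem (by exact hη)]
      exact h1 η hη
    · rw [Set.indicator_of_notMem (by exact hη), h0 η (not_le.mp hη), norm_zero]
  refine hle.trans (le_of_eq ?_)
  rw [integral_indicator measurableSet_Ici, integral_Ici_eq_integral_Ioi]
  have : ∫ η in Set.Ioi ρ, K / η ^ 2 = ∫ η in Set.Ioi ρ, K * η ^ (-2 : ℝ) :=
    setIntegral_congr_fun measurableSet_Ioi fun η hη =>
      (mul_rpow_neg_two_eq_div_sq K (hρ.trans hη)).symm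
  rw [this, integral_const_mul, integral_Ioi_rpow_of_lt (by norm_num) hρ]
  norm_num [Real.rpow_neg_one]
  ring

/-! ### Rapid decay away from the expected wave front set, and the definition of the waves. -/

section Decay

variable {E : Type*} [NormedAddCommGroup E] [NormedSpace ℝ E]

/-- The set `V` of covectors stays away from the ray spanned by `ℓ`. -/
def Separated (V : Set (StrongDual ℝ E)) (ℓ : StrongDual ℝ E) : Prop :=
  ∃ M : ℝ, ∀ ζ ∈ V, ∀ η : ℝ, 0 < η → ‖ζ‖ ≤ M * ‖ζ - η • ℓ‖ ∧ η ≤ M * ‖ζ - η • ℓ‖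

variable [MeasureSpace E] [BorelSpace E] [FiniteDimensional ℝ E]
  [(volume : Measure E).IsAddHaarMeasure]

/-- Separation bounds both `1 + ‖ζ‖` and `η` by a multiple of `1 + ‖ζ - ηℓ‖`, whose powers `φ^`
absorbs. The constant depends on `b` only through `C`, so one `K` serves all tails. -/
theorem wavePairing_decay_of_separated {V : Set (StrongDual ℝ E)} {ℓ : StrongDual ℝ E}
    (hV : Separated V ℓ) (s : ℝ) {φ : E → ℂ} (hφ : ContDiff ℝ ∞ φ) (hc : HasCompactSupport φ)
    (C : ℕ → ℝ) (N : ℕ) :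
    ∃ K : ℝ, ∀ (ρ : ℝ) (b : ℝ → ℂ), 0 < ρ → IsSymbol ρ C b → ∀ ζ ∈ V,
      (1 + ‖ζ‖) ^ N * ‖wavePairing b ℓ s φ ζ‖ ≤ K / ρ := by
  obtain ⟨M, hM⟩ := hV
  -- The extra power supplies a second factor `1/η` besides the one from the symbol bound, so the
  -- integrand is `O(1/η²)`.
  obtain ⟨D, hD, hdec⟩ := fourierAt_decay hφ hc (N + 1)
  set M' : ℝ := 1 + |M| with hM'
  have hM'pos : 0 < M' := by positivity
  refine ⟨C 0 * (M' ^ (N + 1) * D), fun ρ b hρ hb ζ hζ => ?_⟩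
  have hC0 := hb.nonneg 0
  rw [wavePairing, show (1 + ‖ζ‖) ^ N * ‖∫ η : ℝ, b η * (expI (η * s) * fourierAt φ (ζ - η • ℓ))‖ =
    ‖∫ η : ℝ, ((1 + ‖ζ‖) ^ N : ℝ) * (b η * (expI (η * s) * fourierAt φ (ζ - η • ℓ)))‖ by
      rw [integral_const_mul, norm_mul, Complex.norm_of_nonneg (by positivity)]]
  refine norm_integral_le_div hρ (fun η hη => by simp [hb.eq_zero η hη]) fun η hη => ?_
  have hη0 : 0 < η := hρ.trans_le hη
  obtain ⟨h1, h2⟩ := hM ζ hζ η hη0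
  set y := ‖ζ - η • ℓ‖ with hy
  have hy0 : 0 ≤ y := norm_nonneg _
  have hMM : M * y ≤ |M| * y := mul_le_mul_of_nonneg_right (le_abs_self M) hy0
  have h1' : 1 + ‖ζ‖ ≤ M' * (1 + y) := by nlinarith [abs_nonneg M]
  have h2' : η ≤ M' * (1 + y) := by nlinarith [abs_nonneg M]
  have hb0 : η * ‖b η‖ ≤ C 0 := by simpa [abs_of_pos hη0] using hb.bound 0 η
  rw [norm_mul, norm_mul, norm_mul, norm_expI, one_mul, Complex.norm_of_nonneg (by positivity),
    le_div_iff₀ (by positivity)]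
  calc (1 + ‖ζ‖) ^ N * (‖b η‖ * ‖fourierAt φ (ζ - η • ℓ)‖) * η ^ 2
      = (η * ‖b η‖) * (((1 + ‖ζ‖) ^ N * η) * ‖fourierAt φ (ζ - η • ℓ)‖) := by ring
    _ ≤ C 0 * (((M' * (1 + y)) ^ N * (M' * (1 + y))) * ‖fourierAt φ (ζ - η • ℓ)‖) := by gcongr
    _ = C 0 * (M' ^ (N + 1) * ((1 + y) ^ (N + 1) * ‖fourierAt φ (ζ - η • ℓ)‖)) := by
        rw [mul_pow]; ring
    _ ≤ C 0 * (M' ^ (N + 1) * D) := by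
        refine mul_le_mul_of_nonneg_left (mul_le_mul_of_nonneg_left (hdec _) ?_) hC0
        positivity

/-- After `N + 1` integrations by parts the amplitude is `O(η^{-N-2})`. Of these powers `N` pay for
`1 + ‖ζ‖ ≲ η(1 + ‖ζ - ηℓ‖)` and two remain for integrability. The lower bound `r ≤ ρ` keeps the
implied constant independent of `ρ`. -/
theorem wavePairing_decay_of_support {ℓ : StrongDual ℝ E} (hℓ : ℓ ≠ 0) (s : ℝ) {φ : E → ℂ}
    (hφ : ContDiff ℝ ∞ φ) (hc : HasCompactSupport φ) (hs : ∀ p ∈ tsupport φ, ℓ p + s ≠ 0)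
    (C : ℕ → ℝ) (N : ℕ) {r : ℝ} (hr : 0 < r) :
    ∃ K : ℝ, ∀ (ρ : ℝ) (b : ℝ → ℂ), r ≤ ρ → IsSymbol ρ C b → ∀ ζ,
      (1 + ‖ζ‖) ^ N * ‖wavePairing b ℓ s φ ζ‖ ≤ K / ρ := by
  obtain ⟨φ', hφ', hc', heq⟩ := exists_wavePairing_eq_iteratedDeriv hℓ s (N + 1) hφ hc hs
  obtain ⟨D, hD, hdec⟩ := fourierAt_decay hφ' hc' N
  refine ⟨C (N + 1) * ((1 / r + ‖ℓ‖) ^ N * D), fun ρ b hrρ hb ζ => ?_⟩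
  have hρ : 0 < ρ := hr.trans_le hrρ
  have hC0 := hb.nonneg (N + 1)
  rw [heq b hb.contDiff (fun j => ⟨_, hb.norm_iteratedDeriv_le hρ j⟩), norm_mul, norm_pow,
    Complex.norm_I, one_pow, one_mul, wavePairing,
    show (1 + ‖ζ‖) ^ N * ‖∫ η : ℝ, iteratedDeriv (N + 1) b η *
      (expI (η * s) * fourierAt φ' (ζ - η • ℓ))‖ =
    ‖∫ η : ℝ, ((1 + ‖ζ‖) ^ N : ℝ) * (iteratedDeriv (N + 1) b η *
      (expI (η * s) * fourierAt φ' (ζ - η • ℓ)))‖ by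
      rw [integral_const_mul, norm_mul, Complex.norm_of_nonneg (by positivity)]]
  refine norm_integral_le_div hρ
    (fun η hη => by simp [hb.iteratedDeriv_eq_zero (N + 1) hη]) fun η hη => ?_
  have hη0 : 0 < η := hρ.trans_le hη
  set y := ‖ζ - η • ℓ‖ with hy
  have hy0 : 0 ≤ y := norm_nonneg _
  have hζ : ‖ζ‖ ≤ y + η * ‖ℓ‖ := by
    have := norm_add_le (ζ - η • ℓ) (η • ℓ)
    rwa [sub_add_cancel, norm_smul, Real.norm_of_nonneg hη0.le] at this
  have h1 : 1 + ‖ζ‖ ≤ (η * (1 / r + ‖ℓ‖)) * (1 + y) := by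
    have h2 : 1 ≤ η * (1 / r) := by
      rw [mul_one_div, le_div_iff₀ hr, one_mul]; exact hrρ.trans hη
    have h3 : 0 ≤ η * ‖ℓ‖ := by positivity
    nlinarith
  have hb0 : η ^ (N + 2) * ‖iteratedDeriv (N + 1) b η‖ ≤ C (N + 1) := by
    simpa [abs_of_pos hη0] using hb.bound (N + 1) η
  rw [norm_mul, norm_mul, norm_mul, norm_expI, one_mul, Complex.norm_of_nonneg (by positivity),
    le_div_iff₀ (by positivity)]
  calc (1 + ‖ζ‖) ^ N * (‖iteratedDeriv (N + 1) b η‖ * ‖fourierAt φ' (ζ - η • ℓ)‖) * η ^ 2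
      ≤ ((η * (1 / r + ‖ℓ‖)) * (1 + y)) ^ N *
        (‖iteratedDeriv (N + 1) b η‖ * ‖fourierAt φ' (ζ - η • ℓ)‖) * η ^ 2 := by gcongr
    _ = (η ^ (N + 2) * ‖iteratedDeriv (N + 1) b η‖) *
        ((1 / r + ‖ℓ‖) ^ N * ((1 + y) ^ N * ‖fourierAt φ' (ζ - η • ℓ)‖)) := by
        rw [mul_pow, mul_pow]; ring
    _ ≤ C (N + 1) * ((1 / r + ‖ℓ‖) ^ N * D) := by
        gcongr
        exact hdec _

/-- The distribution `∫ b(η) e^{iη(ℓ(p) + s)} dη`, obtained by differentiating along `e` a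
continuous function. -/
noncomputable def wave (b : ℝ → ℂ) (ℓ : StrongDual ℝ E) (s : ℝ) (e : E) : 𝓓'((⊤ : Opens E), ℂ) :=
  Distribution.mapCLM (ContinuousLinearMap.mul ℝ ℂ (-Complex.I))
    (Distribution.lineDerivCLM e (ofFunction fun p => oscFun (fun η => b η / η) (ℓ p + s)))

theorem IsSymbol.integrable_div {r : ℝ} (hr : 0 < r) {C : ℕ → ℝ} {b : ℝ → ℂ}
    (hb : IsSymbol r C b) : Integrable fun η : ℝ => b η / η := by
  refine ((integrable_indicator_iff measurableSet_Ici).mpr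
    (integrableOn_div_sq hr (C 0))).mono' ?_ (Eventually.of_forall fun η => ?_)
  · exact (hb.contDiff.continuous.measurable.div
      Complex.measurable_ofReal).aestronglyMeasurable
  · by_cases hη : r ≤ η
    · rw [Set.indicator_of_mem (by exact hη), norm_div, Complex.norm_real, Real.norm_eq_abs]
      have hη0 : 0 < η := hr.trans_le hη
      have h := hb.bound 0 η
      rw [abs_of_pos hη0] at h ⊢
      rw [div_le_div_iff₀ hη0 (by positivity)]
      simp only [zero_add, pow_one, iteratedDeriv_zero] at h
      nlinarith
    · simp [Set.indicator_of_notMem (show η ∉ Set.Ici r from hη), hb.eq_zero η (not_le.mp hη)]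

/-- Because `ℓ e = 1`, differentiating the test function along `e` multiplies its transform at `-ηℓ`
by `-iη`, which restores the factor divided out to make the amplitude integrable. -/
theorem wave_apply {r : ℝ} (hr : 0 < r) {C : ℕ → ℝ} {b : ℝ → ℂ} (hb : IsSymbol r C b)
    {ℓ : StrongDual ℝ E} (s : ℝ) {e : E} (he : ℓ e = 1) (g : 𝓓((⊤ : Opens E), ℝ)) :
    wave b ℓ s e g = wavePairing b ℓ s (fun p => (g p : ℂ)) 0 := by
  have hgd : ∀ p, fderiv ℝ (fun p => (g p : ℂ)) p e =
      (((TestFunction.lineDerivCLM ℝ e g : 𝓓((⊤ : Opens E), ℝ)) p : ℝ) : ℂ) := by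
    intro p
    have hd : DifferentiableAt ℝ g p := (g.contDiff.differentiable (by simp)).differentiableAt
    have := (Complex.ofRealCLM.hasFDerivAt (x := g p)).comp p hd.hasFDerivAt
    rw [TestFunction.lineDerivCLM_apply_of_le (by simp), hd.lineDeriv_eq_fderiv]
    erw [this.fderiv]
    simp
  have h : wave b ℓ s e g = -Complex.I * -ofFunction (fun p => oscFun (fun η => b η / η) (ℓ p + s))
      (TestFunction.lineDerivCLM ℝ e g) := rfl
  rw [h, ofFunction_oscFun_apply (hb.integrable_div hr), neg_mul_neg, wavePairing, wavePairing,
    ← integral_const_mul]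
  refine integral_congr_ae (Eventually.of_forall fun η => ?_)
  simp only
  rw [← funext hgd, fourierAt_fderiv (contDiff_ofReal_testFunction g)
    (hasCompactSupport_ofReal_testFunction g)]
  rcases eq_or_ne η 0 with rfl | hη
  · simp [hb.eq_zero 0 hr]
  · have hη' : (η : ℂ) ≠ 0 := by exact_mod_cast hη
    simp only [zero_sub, neg_apply, smul_apply, he, smul_eq_mul, mul_one]
    push_cast
    field_simp
    rw [Complex.I_sq]
    ring

end Decay

/-! ### Construction of the symbols `m(η)/η` and of their tails. -/

theorem iteratedDeriv_inv_ofReal (κ : ℂ) (k : ℕ) {R : ℝ} (hR : 0 < R) {b : ℝ → ℂ}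
    (hb : ∀ η, R < η → b η = κ * (η : ℂ)⁻¹) :
    ∃ c : ℂ, ∀ η, R < η → iteratedDeriv k b η = c * (η : ℂ) ^ (-(k + 1 : ℤ)) := by
  induction k with
  | zero => exact ⟨κ, fun η hη => by simp [hb η hη]⟩
  | succ k ih =>
    obtain ⟨c, hc⟩ := ih
    refine ⟨c * ((-(k + 1 : ℤ) : ℤ) : ℂ), fun η hη => ?_⟩
    have hη0 : (η : ℂ) ≠ 0 := by exact_mod_cast (hR.trans hη).ne'
    have h1 : iteratedDeriv k b =ᶠ[𝓝 η] fun η : ℝ => c * (η : ℂ) ^ (-(k + 1 : ℤ)) := by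
      filter_upwards [Ioi_mem_nhds hη] with x hx using hc x hx
    have h2 := ((hasDerivAt_zpow (-(k + 1 : ℤ)) (η : ℂ) (Or.inl hη0)).comp_ofReal).const_mul c
    rw [iteratedDeriv_succ, h1.deriv_eq, h2.deriv, mul_assoc]
    congr 3

/-- The symbol `m(η)/η` for a smooth function `m` that vanishes below `r` and is eventually
constant. -/
theorem exists_isSymbol_div {m : ℝ → ℝ} (hm : ContDiff ℝ ∞ m) {r R κ : ℝ} (hr : 0 < r)
    (h0 : ∀ η < r, m η = 0) (h1 : ∀ η, R ≤ η → m η = κ) :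
    ∃ C, IsSymbol r C fun η => ((m η / η : ℝ) : ℂ) := by
  set b : ℝ → ℂ := fun η => ((m η / η : ℝ) : ℂ) with hb
  have hb0 : ∀ η < r, b η = 0 := fun η hη => by simp [hb, h0 η hη]
  have hsm : ContDiff ℝ ∞ b := by
    refine Complex.ofRealCLM.contDiff.comp (contDiff_iff_contDiffAt.mpr fun η => ?_)
    rcases lt_or_ge η r with hη | hη
    · refine (contDiffAt_const (c := (0 : ℝ))).congr_of_eventuallyEq ?_
      filter_upwards [Iio_mem_nhds hη] with x hx
      exact (congrArg (· / x) (h0 x hx)).trans (zero_div x)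
    · exact hm.contDiffAt.div contDiffAt_id (hr.trans_le hη).ne'
  have hbound : ∀ k : ℕ, ∃ C : ℝ, ∀ η, |η| ^ (k + 1) * ‖iteratedDeriv k b η‖ ≤ C := by
    intro k
    -- Three ranges: zero below `r`, compactness on `[r, R']`, and an explicit multiple of
    -- `η^{-k-1}` beyond `R'`.
    set R' := max R r with hR'
    have hR'0 : 0 < R' := hr.trans_le (le_max_right _ _)
    obtain ⟨c, hc⟩ := iteratedDeriv_inv_ofReal κ k hR'0 (b := b) fun η hη => by
      simp [hb, h1 η ((le_max_left _ _).trans hη.le), div_eq_mul_inv]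
    have hcont : Continuous fun η : ℝ => |η| ^ (k + 1) * ‖iteratedDeriv k b η‖ :=
      (continuous_abs.pow _).mul
        (hsm.continuous_iteratedDeriv k (by exact_mod_cast le_top)).norm
    obtain ⟨D, hD⟩ := (isCompact_Icc (a := r) (b := R')).exists_bound_of_continuousOn
      hcont.continuousOn
    refine ⟨max (max D ‖c‖) 0, fun η => ?_⟩
    rcases lt_or_ge η r with hη | hη
    · have h1 : b =ᶠ[𝓝 η] fun _ => 0 := by
        filter_upwards [Iio_mem_nhds hη] with x hx using hb0 x hx
      rw [h1.iteratedDeriv_eq k]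
      simp
    · refine le_trans ?_ (le_max_left _ _)
      rcases le_or_gt η R' with hη' | hη'
      · exact (Real.le_norm_self _).trans ((hD η ⟨hη, hη'⟩).trans (le_max_left _ _))
      · refine le_trans (le_of_eq ?_) (le_max_right _ _)
        have hη0 : 0 < η := hR'0.trans hη'
        rw [hc η hη', norm_mul, norm_zpow, Complex.norm_real, Real.norm_eq_abs, zpow_neg]
        have : |η| ≠ 0 := (abs_pos.mpr hη0.ne').ne'
        norm_cast
        field_simp
  choose C hC using hbound
  exact ⟨C, hsm, hb0, hC⟩

/-- Symbol bounds of order `-1` are invariant under this dilation: the support moves out to `[t, ∞)`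
while `C` is unchanged. -/
theorem IsSymbol.rescale {C : ℕ → ℝ} {B : ℝ → ℂ} (hB : IsSymbol 1 C B) {t : ℝ} (ht : 0 < t) :
    IsSymbol t C fun η => (t⁻¹ : ℝ) • B (t⁻¹ * η) where
  contDiff := (hB.contDiff.comp (contDiff_const.mul contDiff_id)).const_smul _
  eq_zero η hη := by
    rw [hB.eq_zero _ (by rwa [inv_mul_lt_iff₀ ht, mul_one]), smul_zero]
  bound k η := by
    have h := hB.bound k (t⁻¹ * η)
    rw [iteratedDeriv_fun_const_smul_field t⁻¹ fun η => B (t⁻¹ * η), iteratedDeriv_comp_const_smul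
      (hB.contDiff.of_le (by exact_mod_cast le_top))]
    refine le_trans (le_of_eq ?_) h
    rw [norm_smul, norm_smul, abs_mul, norm_pow, Real.norm_eq_abs, abs_of_pos (inv_pos.mpr ht)]
    ring

/-- An amplitude `m(η)/η` is, up to symbols supported near infinity, compactly supported. -/
theorem exists_remainder {m : ℝ → ℝ} {r R κ : ℝ} (hr : 0 < r)
    (h0 : ∀ η < r, m η = 0) (h1 : ∀ η, R ≤ η → m η = κ) :
    ∃ (C : ℕ → ℝ) (ρ : ℕ → ℝ → ℂ), (∀ j : ℕ, IsSymbol (j + 1 : ℝ) C (ρ j)) ∧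
      ∀ j, HasCompactSupport fun η => ((m η / η : ℝ) : ℂ) - ρ j η := by
  -- The model tail vanishes below `1` and equals `κ/y` from `2` on; dilated by `j + 1` it agrees
  -- with the amplitude beyond `max R (2(j + 1))`.
  have hm : ContDiff ℝ ∞ fun y => κ * Real.smoothTransition (y - 1) :=
    contDiff_const.mul (Real.smoothTransition.contDiff.comp (contDiff_id.sub contDiff_const))
  obtain ⟨C, hC⟩ := exists_isSymbol_div hm one_pos
    (fun η hη => by simp [Real.smoothTransition.zero_of_nonpos (by linarith : η - 1 ≤ 0)])
    (R := 2) (κ := κ)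
    (fun η hη => by simp [Real.smoothTransition.one_of_one_le (by linarith : 1 ≤ η - 1)])
  refine ⟨C, _, fun j => hC.rescale (by positivity), fun j => ?_⟩
  have hj : (0 : ℝ) < j + 1 := by positivity
  refine HasCompactSupport.of_support_subset_isCompact
    (isCompact_Icc (a := 0) (b := max R (2 * (j + 1)))) fun η hη => ?_
  by_contra hmem
  refine hη ?_
  rw [Set.mem_Icc, not_and_or, not_le, not_le] at hmem
  rcases hmem with hη0 | hη1
  · have h2 : (j + 1 : ℝ)⁻¹ * η ≤ 0 := mul_nonpos_of_nonneg_of_nonpos (by positivity) hη0.le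
    simp [h0 η (hη0.trans hr),
      Real.smoothTransition.zero_of_nonpos (by linarith : (j + 1 : ℝ)⁻¹ * η - 1 ≤ 0)]
  · have hηR := (le_max_left _ _).trans hη1.le
    have hη2 := (le_max_right _ _).trans hη1.le
    have h2 : 2 ≤ (j + 1 : ℝ)⁻¹ * η := by rwa [le_inv_mul_iff₀ hj, mul_comm]
    have hη0 : (η : ℂ) ≠ 0 := by exact_mod_cast (by linarith : 0 < η).ne'
    have hj' : (j + 1 : ℂ) ≠ 0 := by exact_mod_cast hj.ne'
    simp only
    rw [h1 η hηR, Real.smoothTransition.one_of_one_le (by linarith)]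
    rw [Complex.real_smul]
    push_cast
    field_simp
    ring

/-! ### Cones of covectors and their distance to a ray. -/

section Cone

variable {E : Type*} [NormedAddCommGroup E] [NormedSpace ℝ E]

theorem Separated.mono {V W : Set (StrongDual ℝ E)} {ℓ : StrongDual ℝ E} (h : Separated W ℓ)
    (hVW : V ⊆ W) : Separated V ℓ := by
  obtain ⟨M, hM⟩ := h
  exact ⟨M, fun ζ hζ => hM ζ (hVW hζ)⟩

/-- The value of a wave on a test function is the pairing at `ζ = 0`, so this case of separation
yields weak convergence. -/
theorem separated_singleton_zero {ℓ : StrongDual ℝ E} (hℓ : ℓ ≠ 0) :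
    Separated ({0} : Set (StrongDual ℝ E)) ℓ := by
  refine ⟨‖ℓ‖⁻¹, fun ζ hζ η hη => ?_⟩
  rw [Set.mem_singleton_iff.mp hζ, zero_sub, norm_neg, norm_smul, norm_zero,
    Real.norm_of_nonneg hη.le]
  have := norm_pos_iff.mpr hℓ
  exact ⟨by positivity, by field_simp; exact le_rfl⟩

/-- By homogeneity `‖ζ - ηℓ‖ = η ‖η⁻¹ζ - ℓ‖`, and `η⁻¹ζ` stays in `V`, at a fixed distance `δ` from
`ℓ`. -/
theorem separated_of_isClosed {V : Set (StrongDual ℝ E)} (hV : IsClosed V) (hc : IsConic V)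
    {ℓ : StrongDual ℝ E} (hℓ : ℓ ∉ V) : Separated V ℓ := by
  obtain ⟨δ, hδ, hball⟩ := Metric.isOpen_iff.mp hV.isOpen_compl ℓ hℓ
  refine ⟨δ⁻¹ + (1 + ‖ℓ‖ / δ), fun ζ hζ η hη => ?_⟩
  have h1 : δ ≤ ‖η⁻¹ • ζ - ℓ‖ := by
    by_contra hlt
    exact hball (by rwa [Metric.mem_ball, dist_eq_norm, ← not_le])
      (hc ζ hζ η⁻¹ (inv_pos.mpr hη))
  have h2 : δ * η ≤ ‖ζ - η • ℓ‖ := by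
    have : ζ - η • ℓ = η • (η⁻¹ • ζ - ℓ) := by rw [smul_sub, smul_inv_smul₀ hη.ne']
    rw [this, norm_smul, Real.norm_of_nonneg hη.le, mul_comm]
    gcongr
  set y := ‖ζ - η • ℓ‖ with hy
  have hy0 : 0 ≤ y := norm_nonneg _
  have h3 : ‖ζ‖ ≤ y + η * ‖ℓ‖ := by
    have := norm_add_le (ζ - η • ℓ) (η • ℓ)
    rwa [sub_add_cancel, norm_smul, Real.norm_of_nonneg hη.le] at this
  have h4 : η ≤ δ⁻¹ * y := by rwa [le_inv_mul_iff₀ hδ]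
  have h5 : η * ‖ℓ‖ ≤ ‖ℓ‖ / δ * y := by
    calc η * ‖ℓ‖ ≤ δ⁻¹ * y * ‖ℓ‖ := by gcongr
      _ = _ := by ring
  have h6 : 0 ≤ δ⁻¹ * y := by positivity
  have h7 : 0 ≤ ‖ℓ‖ / δ * y := by positivity
  constructor <;> nlinarith

/-- The open cone over a ball. -/
def coneOver (ζ₀ : StrongDual ℝ E) (δ : ℝ) : Set (StrongDual ℝ E) :=
  {ζ | ∃ t : ℝ, 0 < t ∧ t • ζ ∈ Metric.ball ζ₀ δ}

theorem isOpen_coneOver (ζ₀ : StrongDual ℝ E) (δ : ℝ) : IsOpen (coneOver ζ₀ δ) := by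
  have : coneOver ζ₀ δ = ⋃ t ∈ Set.Ioi (0 : ℝ), (fun ζ => t • ζ) ⁻¹' Metric.ball ζ₀ δ := by
    ext ζ
    simp [coneOver]
  rw [this]
  exact isOpen_biUnion fun t _ => Metric.isOpen_ball.preimage (continuous_const_smul t)

theorem isConic_coneOver (ζ₀ : StrongDual ℝ E) (δ : ℝ) : IsConic (coneOver ζ₀ δ) := by
  rintro ζ ⟨t, ht, hζ⟩ t' ht'
  exact ⟨t / t', by positivity, by rwa [smul_smul, div_mul_cancel₀ _ ht'.ne']⟩

theorem mem_coneOver {ζ₀ : StrongDual ℝ E} {δ : ℝ} (hδ : 0 < δ) : ζ₀ ∈ coneOver ζ₀ δ :=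
  ⟨1, one_pos, by simpa using hδ⟩

/-- Evaluation at `e` recovers the coefficient `τ`, so the ray with its vertex is cut out by closed
conditions. -/
theorem isClosed_ray {ℓ : StrongDual ℝ E} {e : E} (he : ℓ e = 1) :
    IsClosed {ζ : StrongDual ℝ E | ∃ τ : ℝ, 0 ≤ τ ∧ ζ = τ • ℓ} := by
  have : {ζ : StrongDual ℝ E | ∃ τ : ℝ, 0 ≤ τ ∧ ζ = τ • ℓ} =
      {ζ | 0 ≤ ζ e} ∩ {ζ | ζ = ζ e • ℓ} := by
    ext ζ
    constructor
    · rintro ⟨τ, hτ, rfl⟩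
      simp [he, hτ]
    · rintro ⟨h1, h2⟩
      exact ⟨ζ e, h1, h2⟩
  rw [this]
  have hev : Continuous fun ζ : StrongDual ℝ E => ζ e := by fun_prop
  exact (isClosed_le continuous_const hev).inter
    (isClosed_eq continuous_id (hev.smul continuous_const))

theorem eventually_separated_coneOver {ζ₀ ℓ : StrongDual ℝ E} {e : E} (he : ℓ e = 1)
    (h0 : ζ₀ ≠ 0) (hray : ∀ τ : ℝ, 0 < τ → ζ₀ ≠ τ • ℓ) :
    ∀ᶠ δ in 𝓝[>] (0 : ℝ), Separated (coneOver ζ₀ δ) ℓ := by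
  have hmem : ζ₀ ∉ {ζ : StrongDual ℝ E | ∃ τ : ℝ, 0 ≤ τ ∧ ζ = τ • ℓ} := by
    rintro ⟨τ, hτ, h⟩
    rcases hτ.eq_or_lt with rfl | hτ
    · exact h0 (by simpa using h)
    · exact hray τ hτ h
  obtain ⟨ε, hε, hball⟩ := Metric.isOpen_iff.mp (isClosed_ray he).isOpen_compl ζ₀ hmem
  have hℓ : 0 < ‖ℓ‖ := norm_pos_iff.mpr fun h => by simp [h] at he
  -- The ray keeps distance `ε` from `ζ₀`; with `δ ≤ ε/2` it keeps distance at least `δ` from the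
  -- ball.
  filter_upwards [Ioc_mem_nhdsGT (half_pos hε)] with δ hδ
  have hδ0 : 0 < δ := hδ.1
  set A := (‖ζ₀‖ + δ) / δ with hA
  have hA0 : 0 < A := by positivity
  refine ⟨A + (1 + A) / ‖ℓ‖, ?_⟩
  rintro ζ ⟨t, ht, hζ⟩ η hη
  rw [Metric.mem_ball, dist_eq_norm] at hζ
  set y := ‖ζ - η • ℓ‖ with hy
  have hy0 : 0 ≤ y := norm_nonneg _
  have hfar : ε ≤ ‖(t * η) • ℓ - ζ₀‖ := by
    by_contra hlt
    exact hball (by rwa [Metric.mem_ball, dist_eq_norm, ← not_le]) ⟨t * η, by positivity, rfl⟩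
  have h1 : δ ≤ t * y := by
    have h2 : ‖(t * η) • ℓ - ζ₀‖ ≤ ‖t • ζ - (t * η) • ℓ‖ + ‖t • ζ - ζ₀‖ := by
      have := norm_sub_le (t • ζ - ζ₀) (t • ζ - (t * η) • ℓ)
      rw [sub_sub_sub_cancel_left] at this
      linarith
    have h3 : ‖t • ζ - (t * η) • ℓ‖ = t * y := by
      have : t • ζ - (t * η) • ℓ = t • (ζ - η • ℓ) := by rw [smul_sub, smul_smul]
      rw [this, norm_smul, Real.norm_of_nonneg ht.le]
    linarith [hδ.2]
  have h2 : t * ‖ζ‖ ≤ ‖ζ₀‖ + δ := by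
    have := norm_add_le (t • ζ - ζ₀) ζ₀
    rw [sub_add_cancel, norm_smul, Real.norm_of_nonneg ht.le] at this
    linarith
  have h3 : ‖ζ‖ ≤ A * y := by
    refine le_of_mul_le_mul_left ?_ ht
    calc t * ‖ζ‖ ≤ A * δ := by rw [hA, div_mul_cancel₀ _ hδ0.ne']; exact h2
      _ ≤ A * (t * y) := by gcongr
      _ = t * (A * y) := by ring
  have h4 : η * ‖ℓ‖ ≤ y + ‖ζ‖ := by
    have := norm_sub_le (ζ - η • ℓ) ζ
    rwa [sub_sub_cancel_left, norm_neg, norm_smul, Real.norm_of_nonneg hη.le] at this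
  have h5 : η ≤ (1 + A) / ‖ℓ‖ * y := by
    rw [div_mul_eq_mul_div, le_div_iff₀ hℓ]
    linarith
  have h6 : 0 ≤ (1 + A) / ‖ℓ‖ * y := by positivity
  have h7 : 0 ≤ A * y := by positivity
  constructor <;> nlinarith

/-- Rapid decay in `V` along a translated ray that stays in `V`. -/
theorem tendsto_mul_of_decay {F : StrongDual ℝ E → ℂ} {V : Set (StrongDual ℝ E)} {K : ℝ}
    (hF : ∀ ζ ∈ V, (1 + ‖ζ‖) ^ 2 * ‖F ζ‖ ≤ K) {ℓ : StrongDual ℝ E} (hℓ : ℓ ≠ 0)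
    (ξ : StrongDual ℝ E) (hmem : ∀ᶠ τ : ℝ in atTop, τ • ℓ + ξ ∈ V) :
    Tendsto (fun τ : ℝ => (τ : ℂ) * F (τ • ℓ + ξ)) atTop (𝓝 0) := by
  have hℓ' : 0 < ‖ℓ‖ := norm_pos_iff.mpr hℓ
  set M := (1 + ‖ξ‖) / ‖ℓ‖ with hM
  have hM0 : 0 < M := by positivity
  rw [tendsto_zero_iff_norm_tendsto_zero]
  refine squeeze_zero' (Eventually.of_forall fun _ => norm_nonneg _) ?_
    (tendsto_const_nhds.div_atTop tendsto_id : Tendsto (fun τ : ℝ => M ^ 2 * K / τ) atTop (𝓝 0))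
  filter_upwards [hmem, eventually_gt_atTop 0] with τ hτ hτ0
  have h1 : τ * ‖ℓ‖ ≤ ‖τ • ℓ + ξ‖ + ‖ξ‖ := by
    have := norm_sub_le (τ • ℓ + ξ) ξ
    rwa [add_sub_cancel_right, norm_smul, Real.norm_of_nonneg hτ0.le] at this
  have h2 : τ ≤ M * (1 + ‖τ • ℓ + ξ‖) := by
    rw [hM, div_mul_eq_mul_div, le_div_iff₀ hℓ']
    nlinarith [norm_nonneg ξ, norm_nonneg (τ • ℓ + ξ)]
  rw [norm_mul, Complex.norm_real, Real.norm_of_nonneg hτ0.le, le_div_iff₀ hτ0]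
  calc τ * ‖F (τ • ℓ + ξ)‖ * τ = τ ^ 2 * ‖F (τ • ℓ + ξ)‖ := by ring
    _ ≤ (M * (1 + ‖τ • ℓ + ξ‖)) ^ 2 * ‖F (τ • ℓ + ξ)‖ := by gcongr
    _ = M ^ 2 * ((1 + ‖τ • ℓ + ξ‖) ^ 2 * ‖F (τ • ℓ + ξ)‖) := by ring
    _ ≤ _ := mul_le_mul_of_nonneg_left (hF _ hτ) (by positivity)

/-- Rescaled by `τ₀/τ`, the translated ray converges to `τ₀ℓ`, an interior point of the cone. -/
theorem eventually_smul_add_mem {V : Set (StrongDual ℝ E)} (hV : IsOpen V) (hVc : IsConic V)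
    {ℓ : StrongDual ℝ E} {τ₀ : ℝ} (hτ₀ : 0 < τ₀) (hmem : τ₀ • ℓ ∈ V) (ξ : StrongDual ℝ E) :
    ∀ᶠ τ : ℝ in atTop, τ • ℓ + ξ ∈ V := by
  have h1 : Tendsto (fun τ : ℝ => τ₀ • ℓ + (τ₀ / τ) • ξ) atTop (𝓝 (τ₀ • ℓ + (0 : ℝ) • ξ)) :=
    tendsto_const_nhds.add ((tendsto_const_nhds.div_atTop tendsto_id).smul_const ξ)
  rw [zero_smul, add_zero] at h1
  filter_upwards [h1.eventually (hV.mem_nhds hmem), eventually_gt_atTop 0] with τ hτ hτ0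
  have h2 := hVc _ hτ (τ / τ₀) (by positivity)
  rwa [smul_add, smul_smul, smul_smul, div_mul_cancel₀ _ hτ₀.ne',
    div_mul_div_cancel₀ hτ₀.ne', div_self hτ0.ne', one_smul] at h2

end Cone

/-! ### Finite sums of waves: the upper bound for the wave front set. -/

section WaveSum

variable {E : Type*} [NormedAddCommGroup E] [NormedSpace ℝ E]

/-- The covectors `τ ℓ i`, `τ > 0`, at the zeros of the phases `ℓ i + s i`. -/
def waveSet {ι : Type*} (ℓ : ι → StrongDual ℝ E) (s : ι → ℝ) : Set (E × StrongDual ℝ E) :=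
  {q | ∃ (i : ι) (τ : ℝ), 0 < τ ∧ ℓ i q.1 + s i = 0 ∧ q.2 = τ • ℓ i}

theorem isClosedConic_waveSet {ι : Type*} [Finite ι] {ℓ : ι → StrongDual ℝ E} (s : ι → ℝ) {e : E}
    (he : ∀ i, ℓ i e = 1) : IsClosedConic (waveSet ℓ s) where
  ne_zero := by
    rintro p ⟨i, τ, hτ, -, h⟩ h0
    have := he i
    rw [h, smul_eq_zero] at h0
    rcases h0 with h0 | h0
    · exact hτ.ne' h0
    · simp [h0] at this
  smul_mem := by
    rintro p ⟨i, τ, hτ, hp, h⟩ t ht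
    exact ⟨i, t * τ, by positivity, hp, by simp only [h, smul_smul]⟩
  closed := by
    intro p hp h0
    -- Adding the zero covector to each ray gives a closed finite union; limit points with nonzero
    -- covector then have `τ > 0`.
    have hcl : IsClosed (⋃ i, ({p | ℓ i p + s i = 0} : Set E) ×ˢ
        {ζ : StrongDual ℝ E | ∃ τ : ℝ, 0 ≤ τ ∧ ζ = τ • ℓ i}) := by
      refine isClosed_iUnion_of_finite fun i => IsClosed.prod ?_ (isClosed_ray (he i))
      exact isClosed_eq (by fun_prop) continuous_const
    have hsub : waveSet ℓ s ⊆ ⋃ i, ({p | ℓ i p + s i = 0} : Set E) ×ˢ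
        {ζ : StrongDual ℝ E | ∃ τ : ℝ, 0 ≤ τ ∧ ζ = τ • ℓ i} := by
      rintro q ⟨i, τ, hτ, hq, h⟩
      exact Set.mem_iUnion.mpr ⟨i, hq, τ, hτ.le, h⟩
    obtain ⟨i, h1, τ, hτ, h2⟩ := Set.mem_iUnion.mp (closure_minimal hsub hcl hp)
    refine ⟨i, τ, hτ.lt_of_ne ?_, h1, h2⟩
    rintro rfl
    exact h0 (by simpa using h2)

theorem mulSmooth_apply (φ : 𝓓((⊤ : Opens E), ℝ)) (g : E → ℝ) (hg : ContDiff ℝ ∞ g) (p : E) :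
    mulSmooth φ g hg p = φ p * g p := rfl

variable [MeasureSpace E] [BorelSpace E] [(volume : Measure E).IsAddHaarMeasure]

/-- Euler's formula reassembles the two real test functions in `localFourier` into a frequency shift
by `ζ`. -/
theorem fourierAt_cos_sub_sin (φ : 𝓓((⊤ : Opens E), ℝ)) (ζ ξ : StrongDual ℝ E) :
    fourierAt (fun p => ((mulSmooth φ (fun x => Real.cos (ζ x))
        (Real.contDiff_cos.comp ζ.contDiff) p : ℝ) : ℂ)) ξ -
      Complex.I * fourierAt (fun p => ((mulSmooth φ (fun x => Real.sin (ζ x))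
        (Real.contDiff_sin.comp ζ.contDiff) p : ℝ) : ℂ)) ξ =
    fourierAt (fun p => (φ p : ℂ)) (ζ + ξ) := by
  have hi : ∀ g : 𝓓((⊤ : Opens E), ℝ), Integrable fun p => (g p : ℂ) * expI (-(ξ p)) := fun g =>
    ((contDiff_ofReal_testFunction g).continuous.mul (by fun_prop)).integrable_of_hasCompactSupport
      (hasCompactSupport_ofReal_testFunction g).mul_right
  rw [fourierAt, fourierAt, fourierAt, ← integral_const_mul, ← integral_sub (hi _)
    ((hi _).const_mul _)]
  refine integral_congr_ae (Eventually.of_forall fun p => ?_)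
  simp only [mulSmooth_apply, add_apply, neg_add, expI_add, expI_neg_eq (ζ p)]
  push_cast
  ring

variable [FiniteDimensional ℝ E]

theorem localFourier_wave {r : ℝ} (hr : 0 < r) {C : ℕ → ℝ} {b : ℝ → ℂ} (hb : IsSymbol r C b)
    {ℓ : StrongDual ℝ E} (s : ℝ) {e : E} (he : ℓ e = 1) (φ : 𝓓((⊤ : Opens E), ℝ))
    (ζ : StrongDual ℝ E) :
    localFourier (wave b ℓ s e) φ ζ = wavePairing b ℓ s (fun p => (φ p : ℂ)) ζ := by
  have hℓ : ℓ ≠ 0 := fun h => by simp [h] at he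
  have hi := fun g : 𝓓((⊤ : Opens E), ℝ) => integrable_wave (contDiff_ofReal_testFunction g)
    (hasCompactSupport_ofReal_testFunction g) hℓ 0 s
    hb.contDiff.continuous.aestronglyMeasurable (hb.norm_le hr)
  rw [localFourier, wave_apply hr hb s he, wave_apply hr hb s he, wavePairing, wavePairing,
    ← integral_const_mul, ← integral_sub (hi _) ((hi _).const_mul _)]
  refine integral_congr_ae (Eventually.of_forall fun η => ?_)
  simp only
  rw [sub_eq_add_neg ζ, ← zero_sub, ← fourierAt_cos_sub_sin]
  ring

theorem localFourier_ofFunction {h : E → ℂ} (hh : Continuous h) (φ : 𝓓((⊤ : Opens E), ℝ))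
    (ζ : StrongDual ℝ E) :
    localFourier (ofFunction h) φ ζ = fourierAt (fun p => (φ p : ℂ) * h p) ζ := by
  have hi : ∀ g : 𝓓((⊤ : Opens E), ℝ), Integrable fun p => (g p : ℂ) * h p := fun g =>
    ((contDiff_ofReal_testFunction g).continuous.mul hh).integrable_of_hasCompactSupport
      (hasCompactSupport_ofReal_testFunction g).mul_right
  rw [localFourier, ofFunction_apply hh, ofFunction_apply hh, fourierAt, ← integral_const_mul,
    ← integral_sub (hi _) ((hi _).const_mul _)]
  refine integral_congr_ae (Eventually.of_forall fun p => ?_)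
  simp only [mulSmooth_apply, expI_neg_eq]
  push_cast
  ring

/-- The wave front set of a smooth function is empty. -/
theorem waveFrontSet_ofFunction {h : E → ℂ} (hh : ContDiff ℝ ∞ h) :
    waveFrontSet (ofFunction h) = ∅ := by
  refine Set.eq_empty_iff_forall_notMem.mpr fun q hq => hq.2 ?_
  let b : ContDiffBump q.1 := ⟨1, 2, one_pos, one_lt_two⟩
  let φ : 𝓓((⊤ : Opens E), ℝ) := ⟨b, b.contDiff, b.hasCompactSupport, fun _ _ => trivial⟩
  refine ⟨φ, ?_, Set.univ, isOpen_univ, fun _ _ _ _ => trivial, trivial, fun N => ?_⟩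
  · have : φ q.1 = 1 := b.eventuallyEq_one.eq_of_nhds
    exact this.trans_ne one_ne_zero
  · obtain ⟨C, -, hC⟩ := fourierAt_decay ((contDiff_ofReal_testFunction φ).mul hh)
      (hasCompactSupport_ofReal_testFunction φ).mul_right N
    exact ⟨C, fun ζ _ => by rw [localFourier_ofFunction hh.continuous]; exact hC ζ⟩

variable {ι : Type*} [Fintype ι]

/-- The sum of the waves `∫ b(η) e^{iη(ℓ i(p) + s i)} dη`. -/
noncomputable def waveSum (b : ℝ → ℂ) (ℓ : ι → StrongDual ℝ E) (s : ι → ℝ) (e : E) :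
    𝓓'((⊤ : Opens E), ℂ) := ∑ i, wave b (ℓ i) (s i) e

theorem waveSum_apply {r : ℝ} (hr : 0 < r) {C : ℕ → ℝ} {b : ℝ → ℂ} (hb : IsSymbol r C b)
    {ℓ : ι → StrongDual ℝ E} (s : ι → ℝ) {e : E} (he : ∀ i, ℓ i e = 1)
    (g : 𝓓((⊤ : Opens E), ℝ)) :
    waveSum b ℓ s e g = ∑ i, wavePairing b (ℓ i) (s i) (fun p => (g p : ℂ)) 0 := by
  rw [waveSum, sum_apply]
  exact Finset.sum_congr rfl fun i _ => wave_apply hr hb (s i) (he i) g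

theorem localFourier_waveSum {r : ℝ} (hr : 0 < r) {C : ℕ → ℝ} {b : ℝ → ℂ} (hb : IsSymbol r C b)
    {ℓ : ι → StrongDual ℝ E} (s : ι → ℝ) {e : E} (he : ∀ i, ℓ i e = 1)
    (φ : 𝓓((⊤ : Opens E), ℝ)) (ζ : StrongDual ℝ E) :
    localFourier (waveSum b ℓ s e) φ ζ =
      ∑ i, wavePairing b (ℓ i) (s i) (fun p => (φ p : ℂ)) ζ := by
  rw [← Finset.sum_congr rfl fun i _ => localFourier_wave hr hb (s i) (he i) φ ζ]
  simp only [localFourier, waveSum, sum_apply, Finset.mul_sum, Finset.sum_sub_distrib]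

theorem waveFrontSet_waveSum_subset {r : ℝ} (hr : 0 < r) {C : ℕ → ℝ} {b : ℝ → ℂ}
    (hb : IsSymbol r C b) {ℓ : ι → StrongDual ℝ E} (s : ι → ℝ) {e : E} (he : ∀ i, ℓ i e = 1) :
    waveFrontSet (waveSum b ℓ s e) ⊆ waveSet ℓ s := by
  intro q hq
  by_contra hmem
  refine hq.2 ?_
  -- For each wave one of the two decay mechanisms works at all small scales; having finitely many
  -- waves gives a common `ε`, used for both the support and the cone.
  have key : ∀ i, ∀ᶠ ε in 𝓝[>] (0 : ℝ), (∀ p ∈ Metric.closedBall q.1 ε, ℓ i p + s i ≠ 0) ∨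
      Separated (coneOver q.2 ε) (ℓ i) := by
    intro i
    by_cases hi : ℓ i q.1 + s i = 0
    · refine (eventually_separated_coneOver (he i) hq.1 fun τ hτ h => ?_).mono fun _ => Or.inr
      exact hmem ⟨i, τ, hτ, hi, h⟩
    · have hopen : {p | ℓ i p + s i ≠ 0} ∈ 𝓝 q.1 :=
        (isOpen_ne_fun (by fun_prop) continuous_const).mem_nhds hi
      obtain ⟨ε, hε, hsub⟩ := Metric.nhds_basis_closedBall.mem_iff.mp hopen
      filter_upwards [Ioc_mem_nhdsGT hε] with ε' hε'
      exact Or.inl fun p hp => hsub (Metric.closedBall_subset_closedBall hε'.2 hp)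
  obtain ⟨ε, hε, hε0⟩ := ((eventually_all.mpr key).and self_mem_nhdsWithin).exists
  have hε0 : 0 < ε := hε0
  let β : ContDiffBump q.1 := ⟨ε / 2, ε, half_pos hε0, half_lt_self hε0⟩
  let φ : 𝓓((⊤ : Opens E), ℝ) := ⟨β, β.contDiff, β.hasCompactSupport, fun _ _ => trivial⟩
  have hts : tsupport (fun p => (φ p : ℂ)) ⊆ Metric.closedBall q.1 ε := by
    refine (tsupport_comp_subset Complex.ofReal_zero φ).trans ?_
    exact β.tsupport_eq.subset
  refine ⟨φ, ?_, coneOver q.2 ε, isOpen_coneOver _ _, isConic_coneOver _ _, mem_coneOver hε0,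
    fun N => ?_⟩
  · have : φ q.1 = 1 := β.eventuallyEq_one.eq_of_nhds
    exact this.trans_ne one_ne_zero
  · have hK : ∀ i, ∃ K, ∀ ζ ∈ coneOver q.2 ε,
        (1 + ‖ζ‖) ^ N * ‖wavePairing b (ℓ i) (s i) (fun p => (φ p : ℂ)) ζ‖ ≤ K := by
      intro i
      have hℓ : ℓ i ≠ 0 := fun h => by simpa [h] using he i
      rcases hε i with h | h
      · obtain ⟨K, hK⟩ := wavePairing_decay_of_support hℓ (s i) (contDiff_ofReal_testFunction φ)
          (hasCompactSupport_ofReal_testFunction φ) (fun p hp => h p (hts hp)) C N hr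
        exact ⟨_, fun ζ _ => hK r b le_rfl hb ζ⟩
      · obtain ⟨K, hK⟩ := wavePairing_decay_of_separated h (s i) (contDiff_ofReal_testFunction φ)
          (hasCompactSupport_ofReal_testFunction φ) C N
        exact ⟨_, fun ζ hζ => hK r b hr hb ζ hζ⟩
    choose K hK using hK
    refine ⟨∑ i, K i, fun ζ hζ => ?_⟩
    rw [localFourier_waveSum hr hb s he]
    calc _ ≤ (1 + ‖ζ‖) ^ N * ∑ i, ‖wavePairing b (ℓ i) (s i) (fun p => (φ p : ℂ)) ζ‖ := by
          gcongr
          exact norm_sum_le _ _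
      _ ≤ _ := by
          rw [Finset.mul_sum]
          exact Finset.sum_le_sum fun i _ => hK i ζ hζ

end WaveSum

/-! ### Smooth approximants obtained by removing the tail of the amplitude. -/

section Approximation

variable {E : Type*} [NormedAddCommGroup E] [NormedSpace ℝ E] {ι : Type*} [Fintype ι]

/-- The function `∑ i, ∫ b(η) e^{iη(ℓ i(p) + s i)} dη`. -/
noncomputable def oscSum (b : ℝ → ℂ) (ℓ : ι → StrongDual ℝ E) (s : ι → ℝ) (p : E) : ℂ :=
  ∑ i, oscFun b (ℓ i p + s i)

theorem contDiff_oscSum {b : ℝ → ℂ} (hb : Continuous b) (hc : HasCompactSupport b)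
    (ℓ : ι → StrongDual ℝ E) (s : ι → ℝ) : ContDiff ℝ ∞ (oscSum b ℓ s) :=
  ContDiff.sum fun i _ => (contDiff_oscFun hb hc).comp ((ℓ i).contDiff.add contDiff_const)

variable [MeasureSpace E] [BorelSpace E] [FiniteDimensional ℝ E]
  [(volume : Measure E).IsAddHaarMeasure]

theorem fourierAt_mul_oscSum {b : ℝ → ℂ} (hb : Integrable b) (ℓ : ι → StrongDual ℝ E) (s : ι → ℝ)
    {φ : E → ℂ} (hφ : Continuous φ) (hc : HasCompactSupport φ) (ζ : StrongDual ℝ E) :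
    fourierAt (fun p => φ p * oscSum b ℓ s p) ζ = ∑ i, wavePairing b (ℓ i) (s i) φ ζ := by
  simp only [fourierAt, oscSum,
    ← integral_mul_oscFun hb _ _ (hφ.integrable_of_hasCompactSupport hc)]
  rw [← integral_finsetSum]
  · refine integral_congr_ae (Eventually.of_forall fun p => ?_)
    simp only [Finset.mul_sum, Finset.sum_mul]
    exact Finset.sum_congr rfl fun i _ => by ring
  · intro i _
    exact ((hφ.mul (by fun_prop : Continuous fun p => expI (-(ζ p)))).mul
      ((continuous_oscFun hb).comp
        (by fun_prop : Continuous fun p => ℓ i p + s i))).integrable_of_hasCompactSupport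
      hc.mul_right.mul_right

theorem ofFunction_oscSum_apply {b : ℝ → ℂ} (hb : Continuous b) (hc : HasCompactSupport b)
    (ℓ : ι → StrongDual ℝ E) (s : ι → ℝ) (g : 𝓓((⊤ : Opens E), ℝ)) :
    ofFunction (oscSum b ℓ s) g = ∑ i, wavePairing b (ℓ i) (s i) (fun p => (g p : ℂ)) 0 := by
  rw [ofFunction_apply (contDiff_oscSum hb hc ℓ s).continuous,
    ← fourierAt_mul_oscSum (hb.integrable_of_hasCompactSupport hc) ℓ s
      (contDiff_ofReal_testFunction g).continuous (hasCompactSupport_ofReal_testFunction g)]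
  simp [fourierAt]

theorem wavePairing_sub {r r' : ℝ} (hr : 0 < r) (hr' : 0 < r') {C C' : ℕ → ℝ} {a b : ℝ → ℂ}
    (ha : IsSymbol r C a) (hb : IsSymbol r' C' b) {ℓ : StrongDual ℝ E} (hℓ : ℓ ≠ 0) (s : ℝ)
    {φ : E → ℂ} (hφ : ContDiff ℝ ∞ φ) (hc : HasCompactSupport φ) (ζ : StrongDual ℝ E) :
    wavePairing (fun η => a η - b η) ℓ s φ ζ = wavePairing a ℓ s φ ζ - wavePairing b ℓ s φ ζ := by
  simp only [wavePairing, sub_mul]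
  exact integral_sub
    (integrable_wave hφ hc hℓ ζ s ha.contDiff.continuous.aestronglyMeasurable (ha.norm_le hr))
    (integrable_wave hφ hc hℓ ζ s hb.contDiff.continuous.aestronglyMeasurable (hb.norm_le hr'))

variable {r : ℝ} {C C' : ℕ → ℝ} {a : ℝ → ℂ} {ρ : ℕ → ℝ → ℂ} {ℓ : ι → StrongDual ℝ E} {e : E}

/-- The error is the pairing of the tail `ρ j` at the zero covector, hence at most `K/(j + 1)` for
each wave. -/
theorem tendsto_ofFunction_oscSum (hr : 0 < r) (ha : IsSymbol r C a)
    (hρ : ∀ j : ℕ, IsSymbol (j + 1 : ℝ) C' (ρ j))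
    (hcs : ∀ j, HasCompactSupport fun η => a η - ρ j η)
    (s : ι → ℝ) (he : ∀ i, ℓ i e = 1) (g : 𝓓((⊤ : Opens E), ℝ)) :
    Tendsto (fun j => ofFunction (oscSum (fun η => a η - ρ j η) ℓ s) g) atTop
      (𝓝 (waveSum a ℓ s e g)) := by
  have hℓ : ∀ i, ℓ i ≠ 0 := fun i h => by simpa [h] using he i
  have hcont : ∀ j, Continuous fun η => a η - ρ j η := fun j =>
    ha.contDiff.continuous.sub (hρ j).contDiff.continuous
  simp only [fun j => ofFunction_oscSum_apply (hcont j) (hcs j) ℓ s g, waveSum_apply hr ha s he]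
  refine tendsto_finsetSum _ fun i _ => ?_
  obtain ⟨K, hK⟩ := wavePairing_decay_of_separated (separated_singleton_zero (hℓ i)) (s i)
    (contDiff_ofReal_testFunction g) (hasCompactSupport_ofReal_testFunction g) C' 0
  rw [tendsto_iff_norm_sub_tendsto_zero]
  refine squeeze_zero (fun _ => norm_nonneg _) (fun j => ?_)
    (tendsto_const_div_atTop_nhds_zero_nat K |>.comp (tendsto_add_atTop_nat 1))
  have h := hK (j + 1) (ρ j) (by positivity) (hρ j) 0 rfl
  rw [wavePairing_sub hr (by positivity : (0 : ℝ) < j + 1) ha (hρ j) (hℓ i) (s i)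
    (contDiff_ofReal_testFunction g) (hasCompactSupport_ofReal_testFunction g), sub_sub_cancel_left,
    norm_neg]
  simpa using h

theorem tendstoInCone_oscSum (hr : 0 < r) (ha : IsSymbol r C a)
    (hρ : ∀ j : ℕ, IsSymbol (j + 1 : ℝ) C' (ρ j))
    (hcs : ∀ j, HasCompactSupport fun η => a η - ρ j η)
    (s : ι → ℝ) (he : ∀ i, ℓ i e = 1) :
    TendstoInCone (waveSet ℓ s) (fun j => ofFunction (oscSum (fun η => a η - ρ j η) ℓ s))
      (waveSum a ℓ s e) where
  waveFrontSet_seq_subset j := by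
    have hcont : Continuous fun η => a η - ρ j η :=
      ha.contDiff.continuous.sub (hρ j).contDiff.continuous
    rw [waveFrontSet_ofFunction (contDiff_oscSum hcont (hcs j) ℓ s)]
    exact Set.empty_subset _
  waveFrontSet_subset := waveFrontSet_waveSum_subset hr ha s he
  weak g := tendsto_ofFunction_oscSum hr ha hρ hcs s he g
  fourier := by
    intro φ V hV hVc hdisj N ε hε
    have hφ := contDiff_ofReal_testFunction φ
    have hφc := hasCompactSupport_ofReal_testFunction φ
    have hℓ : ∀ i, ℓ i ≠ 0 := fun i h => by simpa [h] using he i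
    have hts : tsupport (fun p => (φ p : ℂ)) ⊆ tsupport φ :=
      tsupport_comp_subset Complex.ofReal_zero φ
    have hK : ∀ i, ∃ K : ℝ, ∀ j : ℕ, ∀ ζ ∈ V,
        (1 + ‖ζ‖) ^ N * ‖wavePairing (ρ j) (ℓ i) (s i) (fun p => (φ p : ℂ)) ζ‖ ≤ K / (j + 1) := by
      intro i
      -- A zero of the phase on the support puts `(p, ℓ i)` in the wave set and so keeps `ℓ i` out
      -- of `V`: separation applies. Otherwise integration by parts does, for every covector.
      by_cases h : ∃ p ∈ tsupport φ, ℓ i p + s i = 0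
      · obtain ⟨p, hp, hp0⟩ := h
        have hnot : ℓ i ∉ V := fun hmem =>
          hdisj p hp (ℓ i) hmem ⟨i, 1, one_pos, hp0, (one_smul ℝ _).symm⟩
        obtain ⟨K, hK⟩ := wavePairing_decay_of_separated (separated_of_isClosed hV hVc hnot) (s i)
          hφ hφc C' N
        exact ⟨K, fun j ζ hζ => hK (j + 1) (ρ j) (by positivity) (hρ j) ζ hζ⟩
      · obtain ⟨K, hK⟩ := wavePairing_decay_of_support (hℓ i) (s i) hφ hφc
          (fun p hp h0 => h ⟨p, hts hp, h0⟩) C' N one_pos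
        exact ⟨K, fun j ζ _ => hK (j + 1) (ρ j) (by simp) (hρ j) ζ⟩
    choose K hK using hK
    have hlim : Tendsto (fun j : ℕ => (∑ i, K i) / ((j + 1 : ℕ) : ℝ)) atTop (𝓝 0) :=
      (tendsto_const_div_atTop_nhds_zero_nat _).comp (tendsto_add_atTop_nat 1)
    filter_upwards [hlim.eventually (ge_mem_nhds hε)] with j hj ζ hζ
    have hcont : Continuous fun η => a η - ρ j η :=
      ha.contDiff.continuous.sub (hρ j).contDiff.continuous
    rw [localFourier_ofFunction (contDiff_oscSum hcont (hcs j) ℓ s).continuous,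
      fourierAt_mul_oscSum (hcont.integrable_of_hasCompactSupport (hcs j)) ℓ s hφ.continuous hφc,
      localFourier_waveSum hr ha s he, ← Finset.sum_sub_distrib]
    simp only [fun i => wavePairing_sub hr (by positivity : (0 : ℝ) < j + 1) ha (hρ j) (hℓ i) (s i)
      hφ hφc ζ, sub_sub_cancel_left, Finset.sum_neg_distrib, norm_neg]
    refine le_trans ?_ hj
    calc _ ≤ (1 + ‖ζ‖) ^ N * ∑ i, ‖wavePairing (ρ j) (ℓ i) (s i) (fun p => (φ p : ℂ)) ζ‖ := by
          gcongr
          · linarith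
          · exact norm_sum_le _ _
      _ ≤ ∑ i, K i / (j + 1) := by
          rw [Finset.mul_sum]
          exact Finset.sum_le_sum fun i _ => hK i j ζ hζ
      _ = _ := by rw [Finset.sum_div]; push_cast; rfl

end Approximation

/-! ### Oscillatory integrals as limits of cut-off integrals. -/

section Oscillatory

variable {E : Type*} [NormedAddCommGroup E] [NormedSpace ℝ E] [MeasureSpace E] [BorelSpace E]
  [FiniteDimensional ℝ E] [(volume : Measure E).IsAddHaarMeasure]

theorem integrable_wave_cutoff {r : ℝ} (hr : 0 < r) {C : ℕ → ℝ} {a : ℝ → ℂ} (ha : IsSymbol r C a)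
    {ℓ : StrongDual ℝ E} (hℓ : ℓ ≠ 0) (s : ℝ) {φ : E → ℂ} (hφ : ContDiff ℝ ∞ φ)
    (hc : HasCompactSupport φ) {ψ : ℝ → ℂ} (hψ : Continuous ψ) {K : ℝ} (hK : ∀ η, ‖ψ η‖ ≤ K) :
    Integrable fun η : ℝ => a η * ψ η * (expI (η * s) * fourierAt φ (0 - η • ℓ)) :=
  integrable_wave hφ hc hℓ 0 s (ha.contDiff.continuous.mul hψ).aestronglyMeasurable
    fun η => (norm_mul_le _ _).trans (mul_le_mul (ha.norm_le hr η) (hK η) (norm_nonneg _)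
      ((norm_nonneg _).trans (ha.norm_le hr η)))

/-- Once the space variable is integrated out, the integrand decays rapidly in `η` without any
cut-off, so dominated convergence removes it. -/
theorem tendsto_wave_cutoff {r : ℝ} (hr : 0 < r) {C : ℕ → ℝ} {a : ℝ → ℂ} (ha : IsSymbol r C a)
    {ℓ : StrongDual ℝ E} (hℓ : ℓ ≠ 0) (s : ℝ) {φ : E → ℂ} (hφ : ContDiff ℝ ∞ φ)
    (hc : HasCompactSupport φ) {ψ : ℝ → ℂ} (hψ : Continuous ψ) {K : ℝ} (hK : ∀ η, ‖ψ η‖ ≤ K)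
    (hψ0 : ψ 0 = 1) :
    Tendsto (fun ε : ℝ => ∫ η : ℝ, a η * ψ (ε * η) * (expI (η * s) * fourierAt φ (0 - η • ℓ)))
      (𝓝[>] 0) (𝓝 (wavePairing a ℓ s φ 0)) := by
  have hi := integrable_wave_cutoff hr ha hℓ s hφ hc (ψ := fun _ => 1) continuous_const
    (K := 1) (by simp)
  refine tendsto_integral_filter_of_dominated_convergence
    (fun η => K * ‖a η * 1 * (expI (η * s) * fourierAt φ (0 - η • ℓ))‖) ?_ ?_ (hi.norm.const_mul K) ?_
  · exact Eventually.of_forall fun ε => (integrable_wave_cutoff hr ha hℓ s hφ hc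
      (hψ.comp (continuous_const.mul continuous_id)) (fun η => hK (ε * η))).1
  · refine Eventually.of_forall fun ε => Eventually.of_forall fun η => ?_
    rw [mul_right_comm, norm_mul, mul_one, mul_comm]
    exact mul_le_mul_of_nonneg_right (hK _) (norm_nonneg _)
  · refine Eventually.of_forall fun η => ?_
    have h1 : Tendsto (fun ε : ℝ => ψ (ε * η)) (𝓝[>] 0) (𝓝 1) := by
      have : Tendsto (fun ε : ℝ => ψ (ε * η)) (𝓝 0) (𝓝 (ψ (0 * η))) :=
        (hψ.comp (continuous_id.mul continuous_const)).tendsto 0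
      rw [zero_mul, hψ0] at this
      exact this.mono_left nhdsWithin_le_nhds
    simpa using (h1.const_mul (a η)).mul_const (expI (η * s) * fourierAt φ (0 - η • ℓ))

end Oscillatory

section TwoSided

variable {E : Type*} [NormedAddCommGroup E] [NormedSpace ℝ E] [MeasureSpace E] [BorelSpace E]
  [FiniteDimensional ℝ E] [(volume : Measure E).IsAddHaarMeasure]

/-- A two-sided oscillatory integral is the sum of the waves of its two halves. -/
theorem isOscillatoryIntegral_waveSum {r : ℝ} (hr : 0 < r) {C : ℕ → ℝ} {a : ℝ → ℂ}
    (ha : IsSymbol r C a) {ℓ : Bool → StrongDual ℝ E} (s : Bool → ℝ) {e : E} (he : ∀ i, ℓ i e = 1)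
    {phase : E → ℝ → ℝ} {A : ℝ → ℂ}
    (hpos : ∀ p, ∀ ξ, 0 < ξ → phase p ξ = ξ * (ℓ true p + s true))
    (hneg : ∀ p, ∀ ξ, 0 < ξ → phase p (-ξ) = ξ * (ℓ false p + s false))
    (hApos : ∀ ξ, 0 < ξ → A ξ = a ξ) (hAneg : ∀ ξ, 0 < ξ → A (-ξ) = a ξ) :
    IsOscillatoryIntegral phase (fun _ => A) (waveSum a ℓ s e) := by
  intro ψ hψ g
  have hℓ : ∀ i, ℓ i ≠ 0 := fun i h => by simpa [h] using he i
  have hg := contDiff_ofReal_testFunction g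
  have hgc := hasCompactSupport_ofReal_testFunction g
  let Ψ : Bool → ℝ → ℂ := fun i η => ((ψ (if i then η else -η) : ℝ) : ℂ)
  have hΨ : ∀ i, Continuous (Ψ i) := by
    intro i
    cases i
    · exact Complex.continuous_ofReal.comp (ψ.continuous.comp continuous_neg)
    · exact Complex.continuous_ofReal.comp ψ.continuous
  obtain ⟨K, hK⟩ := ψ.continuous.bounded_above_of_compact_support ψ.hasCompactSupport
  have hΨK : ∀ i η, ‖Ψ i η‖ ≤ K := fun i η => by
    simpa only [Ψ, Complex.norm_real] using hK _
  have hΨ0 : ∀ i, Ψ i 0 = 1 := by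
    intro i
    have : ψ 0 = 1 := hψ.self_of_nhds
    simp [Ψ, this]
  let G : Bool → ℝ → ℝ → ℂ := fun i ε η =>
    a η * Ψ i (ε * η) * (expI (η * s i) * fourierAt (fun p => (g p : ℂ)) (0 - η • ℓ i))
  have hGi : ∀ i ε, Integrable (G i ε) := fun i ε =>
    integrable_wave_cutoff hr ha (hℓ i) (s i) hg hgc
      ((hΨ i).comp (continuous_const.mul continuous_id)) (fun η => hΨK i (ε * η))
  have hG0 : ∀ i ε η, η ≤ 0 → G i ε η = 0 := fun i ε η hη => by
    simp [G, ha.eq_zero η (hη.trans_lt hr)]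
  have heq : ∀ ε : ℝ, ∫ θ : ℝ, ∫ x : E,
      Complex.exp (Complex.I * (phase x θ : ℂ)) * A θ * (ψ (ε • θ) : ℂ) * (g x : ℂ) =
      (∫ η, G true ε η) + ∫ η, G false ε η := by
    intro ε
    rw [← integral_neg_eq_self (G false ε), ← integral_add (hGi true ε) (hGi false ε).comp_neg]
    refine integral_congr_ae ?_
    -- Phase and amplitude are only prescribed for `θ ≠ 0`; at every other `θ` exactly one half
    -- contributes.
    filter_upwards [Measure.ae_ne volume 0] with θ hθ
    rcases hθ.lt_or_gt with hθ | hθ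
    · have h := integral_expI_eq_cutoff (fun x => phase x θ) (A θ) (ψ (ε • θ) : ℂ)
        (ℓ := ℓ false) (s := s false) (η := -θ)
        (fun p => by rw [← hneg p (-θ) (by linarith), neg_neg]) g
      rw [h, hG0 true ε θ hθ.le, zero_add]
      simp only [G, Ψ]
      rw [← hAneg (-θ) (by linarith), neg_neg]
      simp
    · have h := integral_expI_eq_cutoff (fun x => phase x θ) (A θ) (ψ (ε • θ) : ℂ)
        (ℓ := ℓ true) (s := s true) (η := θ) (fun p => hpos p θ hθ) g
      rw [h, hG0 false ε (-θ) (by linarith), add_zero]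
      simp only [G, Ψ]
      rw [← hApos θ hθ]
      simp
  simp only [heq]
  rw [waveSum_apply hr ha s he, Fintype.sum_bool]
  exact (tendsto_wave_cutoff hr ha (hℓ true) (s true) hg hgc (hΨ true) (hΨK true) (hΨ0 true)).add
    (tendsto_wave_cutoff hr ha (hℓ false) (s false) hg hgc (hΨ false) (hΨK false) (hΨ0 false))

end TwoSided

/-! ### Asymptotics along the ray of a wave. -/

section LowerBound

variable {E : Type*} [NormedAddCommGroup E] [NormedSpace ℝ E] [MeasureSpace E] [BorelSpace E]
  [FiniteDimensional ℝ E] [(volume : Measure E).IsAddHaarMeasure]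

/-- Asymptotics along the ray of `ℓ` of the localized Fourier transform of a wave. -/
theorem tendsto_wavePairing_ray {r : ℝ} (hr : 0 < r) {C : ℕ → ℝ} {a : ℝ → ℂ} (ha : IsSymbol r C a)
    {κ : ℂ} {R : ℝ} (hκ : ∀ η : ℝ, R ≤ η → η * a η = κ)
    {ℓ : StrongDual ℝ E} (hℓ : ℓ ≠ 0) (s : ℝ) {φ : E → ℂ} (hφ : ContDiff ℝ ∞ φ)
    (hc : HasCompactSupport φ) (ξ : StrongDual ℝ E) :
    Tendsto (fun τ : ℝ => τ * (expI (-(τ * s)) * wavePairing a ℓ s φ (τ • ℓ + ξ))) atTop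
      (𝓝 (κ * ∫ σ : ℝ, expI (-(σ * s)) * fourierAt φ (ξ + σ • ℓ))) := by
  have hfun : ∀ τ : ℝ, τ * (expI (-(τ * s)) * wavePairing a ℓ s φ (τ • ℓ + ξ)) =
      ∫ σ : ℝ, (τ * a (τ - σ)) * (expI (-(σ * s)) * fourierAt φ (ξ + σ • ℓ)) := by
    intro τ
    -- The substitution `η = τ - σ` freezes the argument of `φ^` at `ξ + σℓ`; all dependence on `τ`
    -- is now in `τ a(τ - σ)`, which tends to `κ`.
    rw [wavePairing, ← integral_sub_left_eq_self _ volume τ, ← integral_const_mul,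
      ← integral_const_mul]
    refine integral_congr_ae (Eventually.of_forall fun σ => ?_)
    simp only
    have h1 : τ • ℓ + ξ - (τ - σ) • ℓ = ξ + σ • ℓ := by module
    have h2 : expI (-(σ * s)) = expI (-(τ * s)) * expI ((τ - σ) * s) := by
      rw [← expI_add]; congr 1; ring
    rw [h1, h2]
    ring
  simp only [hfun]
  rw [← integral_const_mul]
  have hb0 : ∀ η : ℝ, |η| * ‖a η‖ ≤ C 0 := fun η => by simpa using ha.bound 0 η
  have hC0 := ha.nonneg 0
  set D := C 0 + C 0 / r with hD
  have hD0 : 0 ≤ D := by positivity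
  have hint := integrable_fourierAt_line hφ hc (neg_ne_zero.mpr hℓ) ξ 1
  simp only [smul_neg, sub_neg_eq_add, pow_one] at hint
  have hcφ : Continuous fun σ : ℝ => fourierAt φ (ξ + σ • ℓ) := by
    simpa only [smul_neg, sub_neg_eq_add] using continuous_fourierAt_line hφ hc (-ℓ) ξ
  refine tendsto_integral_filter_of_dominated_convergence
    (fun σ => D * ((1 + |σ|) * ‖fourierAt φ (ξ + σ • ℓ)‖)) ?_ ?_ (hint.const_mul D) ?_
  · refine Eventually.of_forall fun τ => ?_
    refine Continuous.aestronglyMeasurable ?_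
    exact (continuous_const.mul (ha.contDiff.continuous.comp (by fun_prop))).mul
      ((by fun_prop : Continuous fun σ : ℝ => expI (-(σ * s))).mul hcφ)
  · refine Eventually.of_forall fun τ => Eventually.of_forall fun σ => ?_
    rw [norm_mul, norm_mul, norm_mul, norm_expI, one_mul, ← mul_assoc, Complex.norm_real,
      Real.norm_eq_abs]
    refine mul_le_mul_of_nonneg_right ?_ (norm_nonneg _)
    have h1 : |τ| ≤ |τ - σ| + |σ| := by
      have := abs_add_le (τ - σ) σ
      rwa [sub_add_cancel] at this
    have h2 := ha.norm_le hr (τ - σ)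
    -- The first summand is controlled by the symbol bound, the second by the sup norm of `a`,
    -- giving a bound uniform in `τ`.
    calc |τ| * ‖a (τ - σ)‖ ≤ (|τ - σ| + |σ|) * ‖a (τ - σ)‖ := by gcongr
      _ = |τ - σ| * ‖a (τ - σ)‖ + |σ| * ‖a (τ - σ)‖ := by ring
      _ ≤ C 0 + |σ| * (C 0 / r) := by gcongr; exact hb0 _
      _ ≤ D * (1 + |σ|) := by
          have : 0 ≤ C 0 / r := by positivity
          nlinarith [abs_nonneg σ]
  · refine Eventually.of_forall fun σ => ?_
    refine Tendsto.mul_const _ ?_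
    have h0 : Tendsto (fun τ : ℝ => (τ - σ)⁻¹) atTop (𝓝 0) :=
      tendsto_inv_atTop_zero.comp (tendsto_atTop_add_const_right _ (-σ) tendsto_id)
    have h1 : Tendsto (fun τ : ℝ => κ + (σ * κ) * (((τ - σ)⁻¹ : ℝ) : ℂ)) atTop
        (𝓝 (κ + (σ * κ) * ((0 : ℝ) : ℂ))) :=
      tendsto_const_nhds.add (tendsto_const_nhds.mul
        ((Complex.continuous_ofReal.tendsto 0).comp h0))
    simp only [Complex.ofReal_zero, mul_zero, add_zero] at h1
    refine h1.congr' ?_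
    filter_upwards [eventually_ge_atTop (R + σ), eventually_gt_atTop σ] with τ hτ hτ'
    have h2 := hκ (τ - σ) (by linarith)
    have h3 : ((τ : ℂ) - σ) ≠ 0 := by
      exact_mod_cast (sub_pos.mpr hτ').ne'
    push_cast at h2 ⊢
    rw [← h2]
    field_simp
    ring

theorem eq_zero_of_tendsto_expI {y : ℝ} (hy : y ≠ 0) {L L' : ℂ}
    (h : Tendsto (fun τ : ℝ => expI (τ * -y) * L + expI (τ * y) * L') atTop (𝓝 0)) : L' = 0 := by
  -- Shifting `τ` by a quarter period multiplies the two terms by `-i` and `i`; adding `i` times the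
  -- original cancels the first and leaves `2i e^{iτy} L'`, of constant modulus.
  have h1 := (h.const_mul Complex.I).add
    (h.comp (tendsto_atTop_add_const_right _ (Real.pi / 2 / y) tendsto_id))
  have hI : expI (Real.pi / 2) = Complex.I := by
    rw [expI]; push_cast; exact Complex.exp_pi_div_two_mul_I
  have hI' : expI (-(Real.pi / 2)) = -Complex.I := by
    rw [expI, ← Complex.exp_neg_pi_div_two_mul_I]
    congr 1
    push_cast
    ring
  have h2 : ∀ τ : ℝ, Complex.I * (expI (τ * -y) * L + expI (τ * y) * L') +
      (expI ((τ + Real.pi / 2 / y) * -y) * L + expI ((τ + Real.pi / 2 / y) * y) * L') =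
      2 * Complex.I * (expI (τ * y) * L') := by
    intro τ
    have e1 : (τ + Real.pi / 2 / y) * -y = τ * -y + -(Real.pi / 2) := by field_simp; ring
    have e2 : (τ + Real.pi / 2 / y) * y = τ * y + Real.pi / 2 := by field_simp
    rw [e1, e2, expI_add, expI_add, hI, hI']
    ring
  have h3 : Tendsto (fun τ : ℝ => 2 * Complex.I * (expI (τ * y) * L')) atTop (𝓝 0) := by
    rw [mul_zero, add_zero] at h1
    exact h1.congr h2
  have h4 := h3.norm
  simp only [norm_mul, norm_expI, one_mul, norm_zero] at h4
  simpa using tendsto_nhds_unique tendsto_const_nhds h4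

end LowerBound

/-! ### Partial Fourier inversion in the plane. -/

section Plane

theorem continuous_integral_snd {G : ℝ × ℝ → ℂ} (hG : Continuous G) (hc : HasCompactSupport G) :
    Continuous fun y => ∫ t, G (y, t) := by
  have hB : IsCompact (Prod.snd '' tsupport G) := hc.isCompact.image continuous_snd
  have h := continuous_parametric_integral_of_continuous (μ := (volume : Measure ℝ))
    (f := fun y t => G (y, t)) (by simpa [Function.uncurry_def] using! hG) hB
  refine h.congr fun y => setIntegral_eq_integral_of_forall_compl_eq_zero fun t ht => ?_
  exact image_eq_zero_of_notMem_tsupport fun hmem => ht ⟨_, hmem, rfl⟩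

theorem hasCompactSupport_integral_snd {G : ℝ × ℝ → ℂ} (hc : HasCompactSupport G) :
    HasCompactSupport fun y => ∫ t, G (y, t) := by
  refine HasCompactSupport.intro (hc.isCompact.image continuous_fst) fun y hy => ?_
  have : ∀ t, G (y, t) = 0 := fun t =>
    image_eq_zero_of_notMem_tsupport fun hmem => hy ⟨_, hmem, rfl⟩
  simp [this]

/-- Fourier inversion in the first variable, integrated over the second. -/
theorem integral_partial_inversion {G : ℝ × ℝ → ℂ} (hG : Continuous G) (hc : HasCompactSupport G)
    (hi : Integrable fun σ : ℝ => ∫ p : ℝ × ℝ, G p * expI (-(σ * p.1))) (y : ℝ) :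
    ∫ σ : ℝ, (∫ p : ℝ × ℝ, G p * expI (-(σ * p.1))) * expI (σ * y) =
      2 * Real.pi * ∫ t, G (y, t) := by
  have heq : ∀ σ : ℝ, ∫ p : ℝ × ℝ, G p * expI (-(σ * p.1)) =
      ∫ x, (∫ t, G (x, t)) * expI (-(σ * x)) := by
    intro σ
    have hint : Integrable (fun p : ℝ × ℝ => G p * expI (-(σ * p.1))) :=
      (hG.mul (by fun_prop)).integrable_of_hasCompactSupport hc.mul_right
    rw [Measure.volume_eq_prod] at hint ⊢
    rw [integral_prod _ hint]
    simp only [integral_mul_const]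
  have hk := continuous_integral_snd hG hc
  simp only [heq] at hi ⊢
  exact integral_fourier_inversion hk
    (hk.integrable_of_hasCompactSupport (hasCompactSupport_integral_snd hc)) hi y

@[simp] theorem covector_apply (ξ τ : ℝ) (p : ℝ × ℝ) : covector ξ τ p = ξ * p.1 + τ * p.2 := by
  simp [covector]

@[simp] theorem covectorLine_apply (τ t : ℝ) : covectorLine τ t = τ * t := by
  simp [covectorLine]

theorem hasCompactSupport_sheared {φ : ℝ × ℝ → ℂ} (hc : HasCompactSupport φ) (c : ℝ) :
    HasCompactSupport fun p : ℝ × ℝ => φ (p.2, p.1 + c * p.2) :=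
  hc.comp_homeomorph
    { toFun := fun p => (p.2, p.1 + c * p.2)
      invFun := fun q => (q.2 - c * q.1, q.1)
      left_inv := fun p => by simp
      right_inv := fun q => by simp
      continuous_toFun := by fun_prop
      continuous_invFun := by fun_prop }

/-- In the coordinates `(t - cx, x)`, which preserve area, the covector `dt - c dx` is the first
coordinate, so inversion in that variable becomes available. -/
theorem fourierAt_sheared {φ : ℝ × ℝ → ℂ} (hφ : Continuous φ) (hc : HasCompactSupport φ)
    (c ρ σ : ℝ) :
    fourierAt φ (covector ρ 0 + σ • covector (-c) 1) =
      ∫ p : ℝ × ℝ, (φ (p.2, p.1 + c * p.2) * expI (-(ρ * p.2))) * expI (-(σ * p.1)) := by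
  have hc' := hasCompactSupport_sheared hc c
  have h1 : Integrable fun p : ℝ × ℝ =>
      φ p * expI (-((covector ρ 0 + σ • covector (-c) 1) p)) :=
    (hφ.mul (by fun_prop)).integrable_of_hasCompactSupport hc.mul_right
  have h2 : Integrable fun p : ℝ × ℝ =>
      (φ (p.2, p.1 + c * p.2) * expI (-(ρ * p.2))) * expI (-(σ * p.1)) :=
    (((hφ.comp (by fun_prop)).mul (by fun_prop)).mul
      (by fun_prop)).integrable_of_hasCompactSupport hc'.mul_right.mul_right
  rw [Measure.volume_eq_prod] at h1 h2
  rw [fourierAt, Measure.volume_eq_prod, integral_prod _ h1, integral_prod_symm _ h2]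
  refine integral_congr_ae (Eventually.of_forall fun x => ?_)
  simp only
  rw [← integral_add_right_eq_self _ (c * x)]
  refine integral_congr_ae (Eventually.of_forall fun t => ?_)
  simp only
  rw [mul_assoc, ← expI_add]
  congr 2
  simp
  ring

/-- A function whose Fourier transform has vanishing integral along every translate of the line
spanned by the conormal of a line through the origin vanishes on this line. -/
theorem eq_zero_of_integral_fourierAt_eq_zero {φ : ℝ × ℝ → ℂ} (hφ : ContDiff ℝ ∞ φ)
    (hc : HasCompactSupport φ) (c : ℝ)
    (h : ∀ ρ : ℝ, ∫ σ : ℝ, fourierAt φ (covector ρ 0 + σ • covector (-c) 1) = 0) (x : ℝ) :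
    φ (x, c * x) = 0 := by
  have hc' := hasCompactSupport_sheared hc c
  have hℓ : covector (-c) 1 ≠ 0 := fun h0 => by
    have := congrArg (fun f : StrongDual ℝ (ℝ × ℝ) => f (0, 1)) h0
    simp at this
  -- Inversion across the line, evaluated on it, shows that the Fourier transform of the restriction
  -- of `φ` vanishes at every `ρ`; a second inversion along the line concludes.
  have hz : ∀ ρ : ℝ, ∫ t, φ (t, c * t) * expI (-(ρ * t)) = 0 := by
    intro ρ
    have hi : Integrable fun σ : ℝ => fourierAt φ (covector ρ 0 + σ • covector (-c) 1) := by
      have h1 := integrable_fourierAt_line hφ hc (neg_ne_zero.mpr hℓ) (covector ρ 0) 0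
      simp only [smul_neg, sub_neg_eq_add, pow_zero, one_mul] at h1
      refine (integrable_norm_iff ?_).mp h1
      have := continuous_fourierAt_line hφ hc (-covector (-c) 1) (covector ρ 0)
      simp only [smul_neg, sub_neg_eq_add] at this
      exact this.aestronglyMeasurable
    have hG : Continuous fun p : ℝ × ℝ => φ (p.2, p.1 + c * p.2) * expI (-(ρ * p.2)) :=
      (hφ.continuous.comp (by fun_prop)).mul (by fun_prop)
    have h1 := integral_partial_inversion hG hc'.mul_right
      (by simpa only [fourierAt_sheared hφ.continuous hc] using hi) 0
    simp only [← fourierAt_sheared hφ.continuous hc, mul_zero, expI_zero, mul_one, h ρ,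
      zero_add] at h1
    have hpi : (2 * (Real.pi : ℂ)) ≠ 0 := by
      exact_mod_cast (by positivity : (2 * Real.pi) ≠ 0)
    exact (mul_eq_zero.mp h1.symm).resolve_left hpi
  have hk : Continuous fun t => φ (t, c * t) := hφ.continuous.comp (by fun_prop)
  have hkc : HasCompactSupport fun t => φ (t, c * t) := by
    refine HasCompactSupport.intro (hc.isCompact.image continuous_fst) fun t ht => ?_
    exact image_eq_zero_of_notMem_tsupport fun hmem => ht ⟨_, hmem, rfl⟩
  have h2 := integral_fourier_inversion hk (hk.integrable_of_hasCompactSupport hkc)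
    (by simp only [hz]; exact integrable_zero _ _ _) x
  simp only [hz, zero_mul, integral_zero] at h2
  have hpi : (2 * (Real.pi : ℂ)) ≠ 0 := by
    exact_mod_cast (by positivity : (2 * Real.pi) ≠ 0)
  exact (mul_eq_zero.mp h2.symm).resolve_left hpi

end Plane

/-! ### Restriction to a vertical line and its uniqueness. -/

section Restriction

theorem covector_ne_zero_of_right (ξ : ℝ) {τ : ℝ} (hτ : τ ≠ 0) : covector ξ τ ≠ 0 := fun h0 => by
  have := congrArg (fun f : StrongDual ℝ (ℝ × ℝ) => f (0, 1)) h0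
  simp [hτ] at this

theorem covector_ne_zero_of_left {ξ : ℝ} (hξ : ξ ≠ 0) (τ : ℝ) : covector ξ τ ≠ 0 := fun h0 => by
  have := congrArg (fun f : StrongDual ℝ (ℝ × ℝ) => f (1, 0)) h0
  simp [hξ] at this

theorem smul_covector (t ξ τ : ℝ) : t • covector ξ τ = covector (t * ξ) (t * τ) := by
  simp [covector, smul_smul]

theorem eq_covector_of_apply_eq_zero {ζ : StrongDual ℝ (ℝ × ℝ)} (h : ζ (0, 1) = 0) :
    ζ = covector (ζ (1, 0)) 0 := by
  ext <;> simp [h]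

theorem continuous_timeLine (x : ℝ) : Continuous (timeLine x) :=
  continuous_const.prodMk continuous_id

theorem fderiv_timeLine (x t : ℝ) : fderiv ℝ (timeLine x) t = ContinuousLinearMap.inr ℝ ℝ ℝ :=
  (hasFDerivAt_prodMk_right x t).fderiv

theorem abs_le_norm_covector (σ : ℝ) : |σ| ≤ ‖covector σ 0‖ := by
  have := (covector σ 0).le_opNorm (1, 0)
  simpa [Prod.norm_def] using this

theorem zero_sub_smul_covector (σ : ℝ) : 0 - σ • covector (-1) 0 = covector σ 0 := by
  ext <;> simp

/-- The restriction of a smooth function to a vertical line in terms of its localized Fourier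
transform at the conormals of the line. -/
theorem ofFunction_comp_timeLine {h : ℝ × ℝ → ℂ} (hh : ContDiff ℝ ∞ h) (x : ℝ)
    {φ : 𝓓((⊤ : Opens (ℝ × ℝ)), ℝ)} {g : 𝓓((⊤ : Opens ℝ), ℝ)} (hφ : ∀ t, φ (x, t) = g t) :
    (Integrable fun σ : ℝ => localFourier (ofFunction h) φ (covector σ 0) * expI (σ * x)) ∧
    ∫ σ : ℝ, localFourier (ofFunction h) φ (covector σ 0) * expI (σ * x) =
      2 * Real.pi * ofFunction (h ∘ timeLine x) g := by
  have hG : ContDiff ℝ ∞ fun p => (φ p : ℂ) * h p := (contDiff_ofReal_testFunction φ).mul hh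
  have hGc : HasCompactSupport fun p => (φ p : ℂ) * h p :=
    (hasCompactSupport_ofReal_testFunction φ).mul_right
  have h1 := integrable_fourierAt_line hG hGc
    (covector_ne_zero_of_left (by norm_num : (-1 : ℝ) ≠ 0) 0) 0 0
  have h2 := continuous_fourierAt_line hG hGc (covector (-1) 0) 0
  simp only [zero_sub_smul_covector, pow_zero, one_mul] at h1 h2
  have h3 : Integrable fun σ : ℝ => fourierAt (fun p => (φ p : ℂ) * h p) (covector σ 0) :=
    (integrable_norm_iff h2.aestronglyMeasurable).mp h1
  have h4 : ∀ σ : ℝ, fourierAt (fun p => (φ p : ℂ) * h p) (covector σ 0) =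
      ∫ p : ℝ × ℝ, (φ p : ℂ) * h p * expI (-(σ * p.1)) := fun σ => by simp [fourierAt]
  simp only [localFourier_ofFunction hh.continuous]
  refine ⟨?_, ?_⟩
  · refine h3.norm.mono' ((h2.mul (by fun_prop)).aestronglyMeasurable)
      (Eventually.of_forall fun σ => by simp)
  · have h5 := integral_partial_inversion hG.continuous hGc (by simpa only [h4] using h3) x
    simp only [h4]
    rw [h5, ofFunction_apply (hh.continuous.comp (continuous_timeLine x))]
    simp only [hφ, Function.comp_apply, timeLine]

theorem isClosed_setOf_mem_of_isClosedConic {E : Type*} [NormedAddCommGroup E] [NormedSpace ℝ E]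
    {Γ : Set (E × StrongDual ℝ E)} (hΓ : IsClosedConic Γ) {ζ : StrongDual ℝ E} (hζ : ζ ≠ 0) :
    IsClosed {p | (p, ζ) ∈ Γ} := by
  refine isClosed_of_closure_subset fun p hp => hΓ.closed _ ?_ hζ
  exact map_mem_closure (f := fun p : E => (p, ζ)) (by fun_prop : Continuous fun p : E => (p, ζ)) hp fun _ h => h

/-- Up to positive scaling the line has only the conormals `±dx`, so avoiding all conormals is
avoiding two closed sets of points. -/
theorem exists_conormal_mem {Γ : Set ((ℝ × ℝ) × StrongDual ℝ (ℝ × ℝ))} (hΓ : IsClosedConic Γ)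
    {p : ℝ × ℝ} {ζ : StrongDual ℝ (ℝ × ℝ)} (hζ : ζ (0, 1) = 0) (h : (p, ζ) ∈ Γ) :
    (p, covector 1 0) ∈ Γ ∨ (p, covector (-1) 0) ∈ Γ := by
  have heq := eq_covector_of_apply_eq_zero hζ
  set a := ζ (1, 0) with ha
  rcases lt_trichotomy a 0 with h0 | h0 | h0
  · right
    have := hΓ.smul_mem _ h (-a)⁻¹ (by simpa using h0)
    rw [heq, smul_covector, mul_zero, inv_neg, neg_mul, inv_mul_cancel₀ h0.ne] at this
    exact this
  · refine absurd ?_ (hΓ.ne_zero _ h)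
    simp only
    rw [heq, h0]
    simp [covector]
  · left
    have := hΓ.smul_mem _ h a⁻¹ (inv_pos.mpr h0)
    rw [heq, smul_covector, mul_zero, inv_mul_cancel₀ h0.ne'] at this
    exact this

/-- The two approximating sequences may come with different sets `Γ`, `Γ'`. Near the compact piece
of the line over the support of `g` neither contains a conormal, so both localized transforms
converge on the conormals to that of `u`, rapidly and uniformly. Integrating them over the conormals
recovers the restrictions. -/
theorem isPullback_timeLine_unique {x : ℝ} {u : 𝓓'((⊤ : Opens (ℝ × ℝ)), ℂ)}
    {w w' : 𝓓'((⊤ : Opens ℝ), ℂ)} (hw : IsPullback (timeLine x) u w)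
    (hw' : IsPullback (timeLine x) u w') : w = w' := by
  obtain ⟨Γ, hΓ, hcon, h, hh, hconv, hlim⟩ := hw
  obtain ⟨Γ', hΓ', hcon', h', hh', hconv', hlim'⟩ := hw'
  ext g
  let S : Set ((ℝ × ℝ) × StrongDual ℝ (ℝ × ℝ)) → Set (ℝ × ℝ) := fun Γ =>
    {p | (p, covector 1 0) ∈ Γ} ∪ {p | (p, covector (-1) 0) ∈ Γ}
  have h1 : covector 1 0 ≠ 0 := covector_ne_zero_of_left one_ne_zero 0
  have h2 : covector (-1) 0 ≠ 0 := covector_ne_zero_of_left (by norm_num) 0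
  have hScl : IsClosed (S Γ ∪ S Γ') :=
    ((isClosed_setOf_mem_of_isClosedConic hΓ h1).union
      (isClosed_setOf_mem_of_isClosedConic hΓ h2)).union
    ((isClosed_setOf_mem_of_isClosedConic hΓ' h1).union
      (isClosed_setOf_mem_of_isClosedConic hΓ' h2))
  have hcomp : ∀ ξ t : ℝ, covector ξ 0 ∘L fderiv ℝ (timeLine x) t = 0 := fun ξ t => by
    rw [fderiv_timeLine]
    ext
    simp
  have hdisj : ({x} ×ˢ tsupport g : Set (ℝ × ℝ)) ⊆ (S Γ ∪ S Γ')ᶜ := by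
    rintro ⟨x', t⟩ ⟨hx, -⟩ hmem
    obtain rfl : x' = x := hx
    rcases hmem with (hm | hm) | (hm | hm)
    · exact hcon t _ hm (hcomp 1 t)
    · exact hcon t _ hm (hcomp (-1) t)
    · exact hcon' t _ hm (hcomp 1 t)
    · exact hcon' t _ hm (hcomp (-1) t)
  obtain ⟨δ, hδ, hsub⟩ := (isCompact_singleton.prod
    g.hasCompactSupport.isCompact).exists_thickening_subset_open hScl.isOpen_compl hdisj
  -- Outer radius below `δ`, so that the support of `β ⊗ g` stays in the `δ`-neighbourhood free of
  -- conormals.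
  let β : ContDiffBump x := ⟨δ / 4, δ / 2, by positivity, by linarith⟩
  have hsupp : ∀ p : ℝ × ℝ, p ∉ Metric.closedBall x (δ / 2) ×ˢ tsupport g → β p.1 * g p.2 = 0 := by
    intro p hp
    rw [Set.mem_prod, not_and_or] at hp
    rcases hp with hp | hp
    · have : p.1 ∉ tsupport β := by rwa [β.tsupport_eq]
      rw [image_eq_zero_of_notMem_tsupport this, zero_mul]
    · rw [image_eq_zero_of_notMem_tsupport hp, mul_zero]
  let φ : 𝓓((⊤ : Opens (ℝ × ℝ)), ℝ) :=
    { toFun := fun p => β p.1 * g p.2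
      contDiff' := (β.contDiff.comp contDiff_fst).mul (g.contDiff.comp contDiff_snd)
      hasCompactSupport' := HasCompactSupport.intro
        ((isCompact_closedBall x (δ / 2)).prod g.hasCompactSupport.isCompact) hsupp
      tsupport_subset' := fun _ _ => trivial }
  have hφg : ∀ t, φ (x, t) = g t := fun t => by
    have h1 : β x = 1 := β.eventuallyEq_one.eq_of_nhds
    have h2 : φ (x, t) = β x * g t := rfl
    rw [h2, h1, one_mul]
  have hφS : ∀ p ∈ tsupport φ, p ∉ S Γ ∪ S Γ' := by
    intro p hp
    have hp' : p ∈ Metric.closedBall x (δ / 2) ×ˢ tsupport g := by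
      refine closure_minimal (fun p hp => ?_)
        (Metric.isClosed_closedBall.prod (isClosed_tsupport g)) hp
      by_contra hnot
      exact hp (hsupp p hnot)
    refine hsub (Metric.mem_thickening_iff.mpr ⟨(x, p.2), ⟨rfl, hp'.2⟩, ?_⟩)
    rw [Prod.dist_eq, dist_self, max_lt_iff]
    exact ⟨lt_of_le_of_lt hp'.1 (by linarith), hδ⟩
  let V : Set (StrongDual ℝ (ℝ × ℝ)) := {ζ | ζ (0, 1) = 0}
  have hV : IsClosed V := isClosed_eq (by fun_prop) continuous_const
  have hVc : IsConic V := fun ζ hζ t _ => by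
    have : ζ (0, 1) = 0 := hζ
    simp [V, this]
  have hfou : ∀ N : ℕ, ∀ ε : ℝ, 0 < ε → ∀ᶠ j in atTop, ∀ σ : ℝ,
      |σ| ^ N * ‖localFourier (ofFunction (h j)) φ (covector σ 0) -
        localFourier (ofFunction (h' j)) φ (covector σ 0)‖ ≤ ε := by
    intro N ε hε
    filter_upwards [hconv.fourier φ V hV hVc (fun p hp ζ hζ hm => hφS p hp
        (Or.inl (exists_conormal_mem hΓ hζ hm))) N (ε / 2) (half_pos hε),
      hconv'.fourier φ V hV hVc (fun p hp ζ hζ hm => hφS p hp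
        (Or.inr (exists_conormal_mem hΓ' hζ hm))) N (ε / 2) (half_pos hε)] with j hj hj' σ
    have hmem : covector σ 0 ∈ V := by simp [V]
    have h3 := hj _ hmem
    have h4 := hj' _ hmem
    have h5 := norm_sub_le_norm_sub_add_norm_sub (localFourier (ofFunction (h j)) φ (covector σ 0))
      (localFourier u φ (covector σ 0)) (localFourier (ofFunction (h' j)) φ (covector σ 0))
    rw [norm_sub_rev (localFourier u φ (covector σ 0))] at h5
    calc _ ≤ ‖covector σ 0‖ ^ N * (‖localFourier (ofFunction (h j)) φ (covector σ 0) -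
          localFourier u φ (covector σ 0)‖ + ‖localFourier (ofFunction (h' j)) φ (covector σ 0) -
          localFourier u φ (covector σ 0)‖) := by
          gcongr
          exact abs_le_norm_covector σ
      _ ≤ ε := by rw [mul_add]; linarith
  have hint : Tendsto (fun j => ∫ σ : ℝ, (localFourier (ofFunction (h j)) φ (covector σ 0) -
      localFourier (ofFunction (h' j)) φ (covector σ 0)) * expI (σ * x)) atTop
      (𝓝 (∫ _ : ℝ, 0)) := by
    -- The majorant adds the estimates with weights `1` and `σ²`, each eventually at most `1`.
    refine tendsto_integral_filter_of_dominated_convergence (fun σ => 2 * (1 + σ ^ 2)⁻¹)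
      ?_ ?_ (integrable_inv_one_add_sq.const_mul 2) ?_
    · refine Eventually.of_forall fun j => ?_
      simp only [sub_mul]
      exact ((ofFunction_comp_timeLine (hh j) x hφg).1.sub
        (ofFunction_comp_timeLine (hh' j) x hφg).1).1
    · filter_upwards [hfou 0 1 one_pos, hfou 2 1 one_pos] with j hj0 hj2
      refine Eventually.of_forall fun σ => ?_
      have h3 := hj0 σ
      have h4 := hj2 σ
      rw [sq_abs] at h4
      rw [norm_mul, norm_expI, mul_one, ← div_eq_mul_inv, le_div_iff₀ (by positivity)]
      linarith
    · refine Eventually.of_forall fun σ => ?_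
      rw [tendsto_zero_iff_norm_tendsto_zero]
      simp only [norm_mul, norm_expI, mul_one]
      rw [Metric.tendsto_nhds]
      intro ε hε
      filter_upwards [hfou 0 (ε / 2) (half_pos hε)] with j hj
      have := hj σ
      rw [pow_zero, one_mul] at this
      rw [Real.dist_0_eq_abs, abs_of_nonneg (norm_nonneg _)]
      linarith
  have hdiff : ∀ j, ∫ σ : ℝ, (localFourier (ofFunction (h j)) φ (covector σ 0) -
      localFourier (ofFunction (h' j)) φ (covector σ 0)) * expI (σ * x) =
      2 * Real.pi * ofFunction (h j ∘ timeLine x) g -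
        2 * Real.pi * ofFunction (h' j ∘ timeLine x) g := by
    intro j
    obtain ⟨i1, e1⟩ := ofFunction_comp_timeLine (hh j) x hφg
    obtain ⟨i2, e2⟩ := ofFunction_comp_timeLine (hh' j) x hφg
    simp only [sub_mul]
    rw [integral_sub i1 i2, e1, e2]
  simp only [hdiff, integral_zero] at hint
  have huniq := tendsto_nhds_unique hint
    (((hlim g).const_mul (2 * Real.pi : ℂ)).sub ((hlim' g).const_mul (2 * Real.pi : ℂ)))
  have hpi : (2 * (Real.pi : ℂ)) ≠ 0 := by
    exact_mod_cast (by positivity : (2 * Real.pi) ≠ 0)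
  exact mul_left_cancel₀ hpi (sub_eq_zero.mp huniq.symm)

end Restriction

/-! ### Exact wave front sets and restrictions of the two half-waves. -/

section HalfWaves

/-- The covectors `dt - c dx` and `dt + c dx`. -/
noncomputable def lightCovector (c : ℝ) (i : Bool) : StrongDual ℝ (ℝ × ℝ) :=
  covector (-(cond i c (-c))) 1

theorem lightCovector_apply_right (c : ℝ) (i : Bool) : lightCovector c i (0, 1) = 1 := by
  simp [lightCovector]

variable {r : ℝ} {C : ℕ → ℝ} {a : ℝ → ℂ}

theorem waveFrontSet_waveSum_plane (hr : 0 < r) (ha : IsSymbol r C a) {κ : ℂ} (hκ0 : κ ≠ 0) {R : ℝ}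
    (hκ : ∀ η : ℝ, R ≤ η → η * a η = κ) {c : ℝ} (hc : c ≠ 0) :
    waveFrontSet (waveSum a (lightCovector c) (fun _ => 0) (0, 1)) =
      waveSet (lightCovector c) (fun _ => 0) := by
  have he := lightCovector_apply_right c
  have hne : ∀ i, lightCovector c i ≠ 0 := fun i => covector_ne_zero_of_right _ one_ne_zero
  refine (waveFrontSet_waveSum_subset hr ha _ he).antisymm ?_
  rintro q hq
  have hq0 := (isClosedConic_waveSet (fun _ => 0) he).ne_zero q hq
  obtain ⟨i, τ₀, hτ₀, hq1, hq2⟩ := hq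
  refine ⟨hq0, ?_⟩
  rintro ⟨φ, hφq, V, hV, hVc, hqV, hdec⟩
  -- Second-order decay already contradicts a term of exact order `1/τ`.
  obtain ⟨K, hK⟩ := hdec 2
  have hφ := contDiff_ofReal_testFunction φ
  have hφc := hasCompactSupport_ofReal_testFunction φ
  -- As `c ≠ 0`, the two light covectors span different rays, so the other wave decays rapidly near
  -- this one.
  have hsep : ∀ᶠ δ in 𝓝[>] (0 : ℝ), Separated (coneOver q.2 δ) (lightCovector c (!i)) := by
    refine eventually_separated_coneOver (he _) hq0 fun τ _ h => ?_
    rw [hq2] at h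
    have h1 := congrArg (fun f : StrongDual ℝ (ℝ × ℝ) => f (0, 1)) h
    have h2 := congrArg (fun f : StrongDual ℝ (ℝ × ℝ) => f (1, 0)) h
    simp only [smul_apply, he, smul_eq_mul, mul_one] at h1
    subst h1
    have h3 : lightCovector c i (1, 0) = lightCovector c (!i) (1, 0) :=
      smul_right_injective _ hτ₀.ne' h2
    cases i <;> simp only [lightCovector, covector_apply, Bool.not_true, Bool.not_false, cond_true,
      cond_false] at h3 <;> exact hc (by linarith)
  obtain ⟨δ, hδ, hδ0⟩ := (hsep.and self_mem_nhdsWithin).exists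
  obtain ⟨K', hK'⟩ := wavePairing_decay_of_separated hδ 0 hφ hφc C 2
  rw [hq2] at hqV hK'
  -- Translating the ray by `ρ dx` keeps it eventually in both open cones; all `ρ` are needed to
  -- recover `φ` at a single point of the line.
  have hzero : ∀ ρ : ℝ, ∫ σ : ℝ, fourierAt (fun p => (φ p : ℂ))
      (covector ρ 0 + σ • covector (-(cond i c (-c))) 1) = 0 := by
    intro ρ
    have h1 := tendsto_mul_of_decay hK (hne i) (covector ρ 0)
      (eventually_smul_add_mem hV hVc hτ₀ hqV _)
    have h2 := tendsto_mul_of_decay (fun ζ hζ => hK' r a hr ha ζ hζ) (hne i) (covector ρ 0)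
      (eventually_smul_add_mem (isOpen_coneOver _ δ) (isConic_coneOver _ δ) hτ₀
        (mem_coneOver hδ0) _)
    have h3 := h1.sub h2
    have h4 := tendsto_wavePairing_ray hr ha hκ (hne i) 0 hφ hφc (covector ρ 0)
    have h5 : ∀ τ : ℝ, (τ : ℂ) * localFourier (waveSum a (lightCovector c) (fun _ => 0) (0, 1)) φ
          (τ • lightCovector c i + covector ρ 0) -
        τ * wavePairing a (lightCovector c (!i)) 0 (fun p => (φ p : ℂ))
          (τ • lightCovector c i + covector ρ 0) =
        τ * (expI (-(τ * 0)) * wavePairing a (lightCovector c i) 0 (fun p => (φ p : ℂ))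
          (τ • lightCovector c i + covector ρ 0)) := by
      intro τ
      rw [localFourier_waveSum hr ha _ he, Fintype.sum_bool, mul_zero, neg_zero, expI_zero, one_mul]
      cases i
      · simp only [Bool.not_false]; ring
      · simp only [Bool.not_true]; ring
    have h6 := tendsto_nhds_unique (h3.congr h5) h4
    rw [sub_zero, eq_comm, mul_eq_zero] at h6
    simpa [lightCovector] using h6.resolve_left hκ0
  have h7 := eq_zero_of_integral_fourierAt_eq_zero hφ hφc _ hzero q.1.1
  have h8 : q.1 = (q.1.1, cond i c (-c) * q.1.1) := by
    refine Prod.ext rfl ?_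
    simp only [lightCovector, covector_apply] at hq1
    simp only
    linarith
  rw [← h8] at h7
  exact hφq (by exact_mod_cast h7)

theorem covectorLine_apply_one : covectorLine 1 1 = 1 := by simp

theorem integral_fourierAt_covectorLine {φ : ℝ → ℂ} (hφ : ContDiff ℝ ∞ φ)
    (hc : HasCompactSupport φ) (s : ℝ) :
    ∫ σ : ℝ, expI (-(σ * s)) * fourierAt φ (0 + σ • covectorLine 1) = 2 * Real.pi * φ (-s) := by
  have h1 : ∀ σ : ℝ, fourierAt φ (0 + σ • covectorLine 1) = ∫ t, φ t * expI (-(σ * t)) :=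
    fun σ => by simp [fourierAt]
  have hne : -covectorLine 1 ≠ 0 := fun h => by
    have := congrArg (fun f : StrongDual ℝ ℝ => f 1) h
    simp at this
  have h2 := integrable_fourierAt_line hφ hc hne 0 0
  have h3 := continuous_fourierAt_line hφ hc (-covectorLine 1) 0
  simp only [smul_neg, sub_neg_eq_add, pow_zero, one_mul] at h2 h3
  have h4 := (integrable_norm_iff h3.aestronglyMeasurable).mp h2
  simp only [h1] at h4 ⊢
  rw [← integral_fourier_inversion hφ.continuous (hφ.continuous.integrable_of_hasCompactSupport hc)
    h4 (-s)]
  refine integral_congr_ae (Eventually.of_forall fun σ => ?_)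
  simp only [mul_neg]
  ring

theorem waveFrontSet_waveSum_line (hr : 0 < r) (ha : IsSymbol r C a) {κ : ℂ} (hκ0 : κ ≠ 0) {R : ℝ}
    (hκ : ∀ η : ℝ, R ≤ η → η * a η = κ) (y : ℝ) :
    waveFrontSet (waveSum a (fun _ : Bool => covectorLine 1) (fun i => cond i (-y) y) 1) =
      waveSet (fun _ : Bool => covectorLine 1) (fun i => cond i (-y) y) := by
  have he : ∀ _ : Bool, covectorLine 1 1 = 1 := fun _ => covectorLine_apply_one
  have hne : covectorLine 1 ≠ 0 := fun h => by simpa [h] using covectorLine_apply_one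
  refine (waveFrontSet_waveSum_subset hr ha _ he).antisymm ?_
  rintro q hq
  have hq0 := (isClosedConic_waveSet _ he).ne_zero q hq
  obtain ⟨i, τ₀, hτ₀, hq1, hq2⟩ := hq
  refine ⟨hq0, ?_⟩
  rintro ⟨φ, hφq, V, hV, hVc, hqV, hdec⟩
  obtain ⟨K, hK⟩ := hdec 2
  have hφ := contDiff_ofReal_testFunction φ
  have hφc := hasCompactSupport_ofReal_testFunction φ
  rw [hq2] at hqV
  have h1 := tendsto_mul_of_decay hK hne 0 (eventually_smul_add_mem hV hVc hτ₀ hqV _)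
  -- The oscillating factor is moved onto the limit, so that waves with different `s` can be added.
  have hray : ∀ s : ℝ, Tendsto (fun τ : ℝ => expI (τ * s) * (κ * (2 * Real.pi * φ (-s))) -
      τ * wavePairing a (covectorLine 1) s (fun p => (φ p : ℂ)) (τ • covectorLine 1 + 0)) atTop
      (𝓝 0) := by
    intro s
    have h2 := tendsto_wavePairing_ray hr ha hκ hne s hφ hφc 0
    rw [integral_fourierAt_covectorLine hφ hφc] at h2
    have h3 := (tendsto_const_nhds (x := κ * (2 * Real.pi * (φ (-s) : ℂ)))).sub h2
    rw [sub_self] at h3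
    have h4 := h3.norm
    rw [tendsto_zero_iff_norm_tendsto_zero]
    rw [norm_zero] at h4
    refine h4.congr fun τ => ?_
    have hn : ∀ z : ℂ, ‖z‖ = ‖expI (τ * s) * z‖ := fun z => by rw [norm_mul, norm_expI, one_mul]
    refine (hn _).trans (congrArg norm ?_)
    rw [mul_sub]
    congr 1
    have : expI (τ * s) * expI (-(τ * s)) = 1 := by rw [← expI_add]; simp
    linear_combination (τ * wavePairing a (covectorLine 1) s (fun p => (φ p : ℂ))
      (τ • covectorLine 1 + 0)) * this
  have hsum : Tendsto (fun τ : ℝ => expI (τ * -y) * (κ * (2 * Real.pi * φ y)) +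
      expI (τ * y) * (κ * (2 * Real.pi * φ (-y)))) atTop (𝓝 0) := by
    have h5 := ((hray (-y)).add (hray y)).add h1
    rw [neg_neg, add_zero, add_zero] at h5
    refine h5.congr fun τ => ?_
    rw [localFourier_waveSum hr ha _ he, Fintype.sum_bool]
    simp only [cond_true, cond_false]
    ring
  have hconst : ∀ z : ℝ, κ * (2 * Real.pi * (φ z : ℂ)) = 0 → φ z = 0 := by
    intro z hz
    have hpi : (2 * (Real.pi : ℂ)) ≠ 0 := by
      exact_mod_cast (by positivity : (2 * Real.pi) ≠ 0)
    exact_mod_cast (mul_eq_zero.mp ((mul_eq_zero.mp hz).resolve_left hκ0)).resolve_left hpi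
  have hboth : φ y = 0 ∧ φ (-y) = 0 := by
    -- At `y = 0` the two waves coincide and add up to twice the same term; otherwise their
    -- frequencies `±y` are distinct.
    rcases eq_or_ne y 0 with rfl | hy
    · simp only [neg_zero, mul_zero, expI_zero, one_mul] at hsum
      have h6 := tendsto_nhds_unique hsum tendsto_const_nhds
      rw [← two_mul, eq_comm, mul_eq_zero] at h6
      have h7 := hconst 0 (h6.resolve_left two_ne_zero)
      exact ⟨h7, by rwa [neg_zero]⟩
    · refine ⟨hconst y (eq_zero_of_tendsto_expI (neg_ne_zero.mpr hy)
        (L := κ * (2 * Real.pi * φ (-y))) ?_), hconst (-y) (eq_zero_of_tendsto_expI hy hsum)⟩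
      rw [neg_neg]
      exact hsum.congr fun τ => add_comm _ _
  simp only [covectorLine_apply, one_mul] at hq1
  cases i
  · rw [cond_false] at hq1
    exact hφq (by rw [eq_neg_of_add_eq_zero_left hq1]; exact hboth.2)
  · rw [cond_true] at hq1
    exact hφq (by rw [eq_of_sub_eq_zero (a := q.1) (b := y) (by linarith)]; exact hboth.1)

/-- No `τ ℓ i` is conormal to the line, since its `dt` component is `τ > 0`. The planar approximants
restrict exactly to the one-dimensional ones, whose convergence is known. -/
theorem isPullback_waveSum (hr : 0 < r) (ha : IsSymbol r C a) {C' : ℕ → ℝ} {ρ : ℕ → ℝ → ℂ}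
    (hρ : ∀ j : ℕ, IsSymbol (j + 1 : ℝ) C' (ρ j))
    (hcs : ∀ j, HasCompactSupport fun η => a η - ρ j η) (c x : ℝ) :
    IsPullback (timeLine x) (waveSum a (lightCovector c) (fun _ => 0) (0, 1))
      (waveSum a (fun _ : Bool => covectorLine 1) (fun i => cond i (-(c * x)) (c * x)) 1) := by
  have he := lightCovector_apply_right c
  have hcont : ∀ j, Continuous fun η => a η - ρ j η := fun j =>
    ha.contDiff.continuous.sub (hρ j).contDiff.continuous
  refine ⟨waveSet (lightCovector c) (fun _ => 0), isClosedConic_waveSet _ he, ?_,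
    fun j => oscSum (fun η => a η - ρ j η) (lightCovector c) (fun _ => 0),
    fun j => contDiff_oscSum (hcont j) (hcs j) _ _, tendstoInCone_oscSum hr ha hρ hcs _ he,
    fun g => ?_⟩
  · rintro t η ⟨i, τ, hτ, -, h⟩ h0
    simp only at h
    have := congrArg (fun f : StrongDual ℝ ℝ => f 1) h0
    simp [fderiv_timeLine, h, lightCovector_apply_right] at this
    exact hτ.ne' this
  · have hcomp : ∀ j, oscSum (fun η => a η - ρ j η) (lightCovector c) (fun _ => 0) ∘ timeLine x =
        oscSum (fun η => a η - ρ j η) (fun _ : Bool => covectorLine 1)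
          (fun i => cond i (-(c * x)) (c * x)) := by
      intro j
      funext t
      simp only [Function.comp_apply, oscSum, timeLine]
      refine Finset.sum_congr rfl fun i _ => congrArg _ ?_
      cases i <;> simp [lightCovector] <;> ring
    simp only [hcomp]
    exact tendsto_ofFunction_oscSum hr ha hρ hcs _ (fun _ => covectorLine_apply_one) g

end HalfWaves

/-! ### Explicit parametrizations and the conclusion. -/

theorem waveSet_lightCovector {γ : ℝ} (hγ : 0 < γ) :
    waveSet (lightCovector γ⁻¹) (fun _ => 0) =
      {q | ∃ t ξ : ℝ, (0 < ξ ∧ q = ((γ * t, t), covector (-ξ / γ) |ξ|)) ∨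
        (ξ < 0 ∧ q = ((γ * t, -t), covector (-ξ / γ) |ξ|))} := by
  ext ⟨⟨x, t⟩, ζ⟩
  constructor
  · rintro ⟨i, τ, hτ, h1, h2⟩
    simp only [lightCovector, covector_apply, smul_covector] at h1 h2
    cases i
    -- The half-wave `false` comes from `ξ = -τ < 0`; there the parameter is minus the time
    -- coordinate.
    · refine ⟨-t, -τ, Or.inr ⟨by linarith, ?_⟩⟩
      rw [h2, abs_neg, abs_of_pos hτ]
      simp only [cond_false] at h1 ⊢
      have hx : x = γ * -t := by field_simp at h1; linarith
      rw [← hx, neg_neg]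
      congr 2 <;> ring
    · refine ⟨t, τ, Or.inl ⟨hτ, ?_⟩⟩
      rw [h2, abs_of_pos hτ]
      simp only [cond_true] at h1 ⊢
      have hx : x = γ * t := by field_simp at h1; linarith
      rw [← hx]
      congr 2 <;> ring
  · rintro ⟨t', ξ, ⟨hξ, h⟩ | ⟨hξ, h⟩⟩
    · simp only [Prod.mk.injEq] at h
      obtain ⟨⟨rfl, rfl⟩, rfl⟩ := h
      refine ⟨true, ξ, hξ, ?_, ?_⟩
      · simp [lightCovector, hγ.ne']
      · simp only [lightCovector, smul_covector, abs_of_pos hξ, cond_true]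
        congr 1 <;> ring
    · simp only [Prod.mk.injEq] at h
      obtain ⟨⟨rfl, rfl⟩, rfl⟩ := h
      refine ⟨false, -ξ, by linarith, ?_, ?_⟩
      · simp [lightCovector, hγ.ne']
      · simp only [lightCovector, smul_covector, abs_of_neg hξ, cond_false]
        congr 1 <;> ring

theorem waveSet_covectorLine (y : ℝ) :
    waveSet (fun _ : Bool => covectorLine 1) (fun i => cond i (-y) y) =
      {q | (q.1 = y ∨ q.1 = -y) ∧ ∃ ξ : ℝ, 0 < ξ ∧ q.2 = covectorLine ξ} := by
  have hs : ∀ τ : ℝ, τ • covectorLine 1 = covectorLine τ := fun τ => by simp [covectorLine]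
  ext ⟨t, ζ⟩
  constructor
  · rintro ⟨i, τ, hτ, h1, h2⟩
    simp only [covectorLine_apply, one_mul, hs] at h1 h2
    refine ⟨?_, τ, hτ, h2⟩
    cases i
    · exact Or.inr (eq_neg_of_add_eq_zero_left h1)
    · exact Or.inl (by simp only [cond_true] at h1; simp only; linarith)
  · rintro ⟨h1, τ, hτ, h2⟩
    simp only at h1 h2
    rcases h1 with rfl | rfl
    · exact ⟨true, τ, hτ, by simp, by rw [hs]; exact h2⟩
    · exact ⟨false, τ, hτ, by simp, by rw [hs]; exact h2⟩

theorem exists_dilated_solution (χ : ℝ → ℝ) (hsmooth : ContDiff ℝ ∞ χ) (heven : ∀ ξ, χ (-ξ) = χ ξ)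
    (hzero : ∀ᶠ ξ in 𝓝 (0 : ℝ), χ ξ = 0) (hone : ∀ ξ, 1 ≤ |ξ| → χ ξ = 1)
    (γ : ℝ) (hγ : 0 < γ) :
    ∃ v : 𝓓'((⊤ : Opens (ℝ × ℝ)), ℂ),
      IsOscillatoryIntegral (F := ℝ)
        (fun p ξ => p.2 * |ξ| - p.1 * ξ / γ) (fun _ ξ => ((χ (ξ / γ) / (γ * |ξ|) : ℝ) : ℂ)) v ∧
      waveFrontSet v =
        {q | ∃ t ξ : ℝ,
          (0 < ξ ∧ q = ((γ * t, t), covector (-ξ / γ) |ξ|)) ∨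
          (ξ < 0 ∧ q = ((γ * t, -t), covector (-ξ / γ) |ξ|))} ∧
      ∀ x : ℝ, ∃ vx : 𝓓'((⊤ : Opens ℝ), ℂ),
        (∀ w, IsPullback (timeLine x) v w ↔ w = vx) ∧
        IsOscillatoryIntegral (F := ℝ)
          (fun t ξ => t * |ξ| - x * ξ / γ) (fun _ ξ => ((χ (ξ / γ) / (γ * |ξ|) : ℝ) : ℂ)) vx ∧
        waveFrontSet vx =
          {q | (q.1 = x / γ ∨ q.1 = -(x / γ)) ∧ ∃ ξ : ℝ, 0 < ξ ∧ q.2 = covectorLine ξ} := by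
  obtain ⟨δ, hδ, hball⟩ := Metric.eventually_nhds_iff.mp hzero
  have hχ0 : ∀ ξ : ℝ, |ξ| < δ → χ ξ = 0 := fun ξ hξ => hball (by simpa using hξ)
  -- Truncation to `η > 0` stays smooth because `χ` vanishes near `0`; evenness of `χ` lets one `m`
  -- serve both halves.
  let m : ℝ → ℝ := fun η => if 0 < η then χ (η / γ) / γ else 0
  have hr : 0 < γ * δ := by positivity
  have hm0 : ∀ η < γ * δ, m η = 0 := by
    intro η hη
    by_cases h : 0 < η
    · have : χ (η / γ) = 0 := hχ0 _ (by rw [abs_of_pos (by positivity), div_lt_iff₀ hγ]; linarith)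
      simp [m, this]
    · simp [m, h]
  have hm1 : ∀ η, γ ≤ η → m η = γ⁻¹ := by
    intro η hη
    have h1 : 0 < η := hγ.trans_le hη
    have : χ (η / γ) = 1 := hone _ (by
      rw [abs_of_pos (by positivity), le_div_iff₀ hγ, one_mul]; exact hη)
    simp [m, h1, this]
  have hm : ContDiff ℝ ∞ m := by
    refine contDiff_iff_contDiffAt.mpr fun η => ?_
    rcases lt_or_ge η (γ * δ) with hη | hη
    · refine (contDiffAt_const (c := (0 : ℝ))).congr_of_eventuallyEq ?_
      filter_upwards [Iio_mem_nhds hη] with y hy using hm0 y hy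
    · have h1 : ContDiff ℝ ∞ fun η : ℝ => χ (η / γ) / γ :=
        (hsmooth.comp (contDiff_id.div_const γ)).div_const γ
      refine h1.contDiffAt.congr_of_eventuallyEq ?_
      filter_upwards [Ioi_mem_nhds (hr.trans_le hη)] with y hy
      exact if_pos hy
  obtain ⟨C, ha⟩ := exists_isSymbol_div hm hr hm0 hm1
  obtain ⟨C', ρ, hρ, hcs⟩ := exists_remainder hr hm0 hm1
  set a : ℝ → ℂ := fun η => ((m η / η : ℝ) : ℂ) with ha_def
  have hκ : ∀ η : ℝ, γ ≤ η → (η : ℂ) * a η = ((γ⁻¹ : ℝ) : ℂ) := by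
    intro η hη
    have h1 : (η : ℂ) ≠ 0 := by exact_mod_cast (hγ.trans_le hη).ne'
    simp only [ha_def, hm1 η hη]
    push_cast
    field_simp
  have hκ0 : ((γ⁻¹ : ℝ) : ℂ) ≠ 0 := by exact_mod_cast (inv_pos.mpr hγ).ne'
  have hApos : ∀ ξ, 0 < ξ → ((χ (ξ / γ) / (γ * |ξ|) : ℝ) : ℂ) = a ξ := by
    intro ξ hξ
    simp only [ha_def, m, if_pos hξ, abs_of_pos hξ, div_div]
  have hAneg : ∀ ξ, 0 < ξ → ((χ (-ξ / γ) / (γ * |-ξ|) : ℝ) : ℂ) = a ξ := by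
    intro ξ hξ
    rw [← hApos ξ hξ, neg_div, heven, abs_neg]
  refine ⟨waveSum a (lightCovector γ⁻¹) (fun _ => 0) (0, 1), ?_, ?_, fun x =>
    ⟨waveSum a (fun _ : Bool => covectorLine 1) (fun i => cond i (-(γ⁻¹ * x)) (γ⁻¹ * x)) 1,
      fun w => ⟨fun hw => ?_, ?_⟩, ?_, ?_⟩⟩
  · refine isOscillatoryIntegral_waveSum hr ha _ (lightCovector_apply_right γ⁻¹)
      (fun p ξ hξ => ?_) (fun p ξ hξ => ?_) hApos hAneg
    · simp only [lightCovector, covector_apply, cond_true, abs_of_pos hξ]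
      ring
    · simp only [lightCovector, covector_apply, cond_false, abs_neg, abs_of_pos hξ]
      ring
  · rw [waveFrontSet_waveSum_plane hr ha hκ0 hκ (inv_pos.mpr hγ).ne', waveSet_lightCovector hγ]
  · exact isPullback_timeLine_unique hw (isPullback_waveSum hr ha hρ hcs γ⁻¹ x)
  · rintro rfl
    exact isPullback_waveSum hr ha hρ hcs γ⁻¹ x
  · refine isOscillatoryIntegral_waveSum hr ha _ (fun _ => covectorLine_apply_one)
      (fun p ξ hξ => ?_) (fun p ξ hξ => ?_) hApos hAneg
    · simp only [covectorLine_apply, cond_true, abs_of_pos hξ]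
      ring
    · simp only [covectorLine_apply, cond_false, abs_neg, abs_of_pos hξ]
      ring
  · rw [waveFrontSet_waveSum_line hr ha hκ0 hκ, waveSet_covectorLine, inv_mul_eq_div]

end Microlocal

theorem mainTheorem6 (χ : ℝ → ℝ) (hsmooth : ContDiff ℝ ∞ χ) (heven : ∀ ξ, χ (-ξ) = χ ξ)
    (hzero : ∀ᶠ ξ in 𝓝 (0 : ℝ), χ ξ = 0) (hone : ∀ ξ, 1 ≤ |ξ| → χ ξ = 1)
    (γ : ℝ) (hγ : 0 < γ) :
    ∃ u v : 𝓓'((⊤ : Opens (ℝ × ℝ)), ℂ),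
      Microlocal.IsOscillatoryIntegral (F := ℝ)
        (fun p ξ => p.2 * |ξ| - p.1 * ξ) (fun _ ξ => ((χ ξ / |ξ| : ℝ) : ℂ)) u ∧
      Microlocal.IsOscillatoryIntegral (F := ℝ)
        (fun p ξ => p.2 * |ξ| - p.1 * ξ / γ) (fun _ ξ => ((χ (ξ / γ) / (γ * |ξ|) : ℝ) : ℂ)) v ∧
      Microlocal.waveFrontSet u =
        {q | ∃ t ξ : ℝ,
          (0 < ξ ∧ q = ((t, t), Microlocal.covector (-ξ) |ξ|)) ∨
          (ξ < 0 ∧ q = ((t, -t), Microlocal.covector (-ξ) |ξ|))} ∧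
      Microlocal.waveFrontSet v =
        {q | ∃ t ξ : ℝ,
          (0 < ξ ∧ q = ((γ * t, t), Microlocal.covector (-ξ / γ) |ξ|)) ∨
          (ξ < 0 ∧ q = ((γ * t, -t), Microlocal.covector (-ξ / γ) |ξ|))} ∧
      ∀ x : ℝ, ∃ ux vx : 𝓓'((⊤ : Opens ℝ), ℂ),
        (∀ w, Microlocal.IsPullback (Microlocal.timeLine x) u w ↔ w = ux) ∧
        (∀ w, Microlocal.IsPullback (Microlocal.timeLine x) v w ↔ w = vx) ∧
        Microlocal.IsOscillatoryIntegral (F := ℝ)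
          (fun t ξ => t * |ξ| - x * ξ) (fun _ ξ => ((χ ξ / |ξ| : ℝ) : ℂ)) ux ∧
        Microlocal.IsOscillatoryIntegral (F := ℝ)
          (fun t ξ => t * |ξ| - x * ξ / γ) (fun _ ξ => ((χ (ξ / γ) / (γ * |ξ|) : ℝ) : ℂ)) vx ∧
        Microlocal.waveFrontSet ux =
          {q | (q.1 = x ∨ q.1 = -x) ∧ ∃ ξ : ℝ, 0 < ξ ∧ q.2 = Microlocal.covectorLine ξ} ∧
        Microlocal.waveFrontSet vx =
          {q | (q.1 = x / γ ∨ q.1 = -(x / γ)) ∧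
            ∃ ξ : ℝ, 0 < ξ ∧ q.2 = Microlocal.covectorLine ξ} := by
  -- The distribution `u` is the case `γ = 1` of `v`.
  obtain ⟨u, hu1, hu2, hu3⟩ :=
    Microlocal.exists_dilated_solution χ hsmooth heven hzero hone 1 one_pos
  obtain ⟨v, hv1, hv2, hv3⟩ := Microlocal.exists_dilated_solution χ hsmooth heven hzero hone γ hγ
  simp only [div_one, one_mul] at hu1 hu2 hu3
  refine ⟨u, v, hu1, hv1, hu2, hv2, fun x => ?_⟩
  obtain ⟨ux, hux1, hux2, hux3⟩ := hu3 x
  obtain ⟨vx, hvx1, hvx2, hvx3⟩ := hv3 x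
  exact ⟨ux, vx, hux1, hvx1, hux2, hvx2, hux3, hvx3⟩
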